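/- Let $\mathfrak g$ be a real Lie algebra. A \emph{Sasakian structure} on $\mathfrak g$ is a quadruple $(\Phi,\alpha,\xi,g)$ with $\Phi\in\mathrm{End}(\mathfrak g)$, $\alpha\in\mathfrak g^*$, $\xi\in\mathfrak g$ and $g$ an inner product on $\mathfrak g$ such that, for all $X,Y\in\mathfrak g$, $$\alpha(\xi)=1,\qquad \Phi^2=-\mathrm I+\xi\otimes\alpha,\qquad g(\Phi X,\Phi Y)=g(X,Y)-\alpha(X)\alpha(Y),$$ $$2g(X,\Phi Y)=d\alpha(X,Y),\qquad N_\Phi=-d\alpha\otimes\xi,$$ where $d\alpha(X,Y)=-\alpha([X,Y])$ and $N_\Phi(X,Y)=\Phi^2[X,Y]+[\Phi X,\Phi Y]-\Phi[\Phi X,Y]-\Phi[X,\Phi Y]$. \textbf{Theorem.} Let $\mathfrak g$ be a $5$-dimensional real Lie algebra which has trivial center and admits a Sasakian structure. Then $\mathfrak g$ is isomorphic to one of the following Lie algebras: the direct product $\mathfrak{sl}(2,\mathbb R)\times\mathfrak{aff}(\mathbb R)$, the direct product $\mathfrak{su}(2)\times\mathfrak{aff}(\mathbb R)$, or the Lie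 algebra $\mathfrak g_0$ with basis $e_1,\dots,e_5$ and brackets $$[e_1,e_3]=e_3,\quad [e_1,e_4]=\tfrac12 e_4,\quad [e_1,e_5]=\tfrac12 e_5,\quad [e_2,e_4]=e_5,\quad [e_2,e_5]=-e_4,\quad [e_4,e_5]=-e_3$$ (all other brackets $[e_i,e_j]$ with $i<j$ being zero). Moreover $\mathfrak g_0$ is solvable, is not unimodular (that is, $\operatorname{tr}(\operatorname{ad}_X)\neq 0$ for some $X\in\mathfrak g_0$), and is isomorphic to a semidirect product $\mathbb R^2\ltimes\mathfrak h_3$. Here $\mathfrak{aff}(\mathbb R)$ is the Lie algebra of the Lie group of affine motions of $\mathbb R$, i.e. the Lie algebra of matrices $\begin{pmatrix}a&b\\0&0\end{pmatrix}$ with $a,b\in\mathbb R$; $\mathfrak h_3$ is the real $3$-dimensional Heisenberg Lie algebra, with basis $X,Y,Z$ and only non-zero bracket $[X,Y]=Z$; and $\mathbb R^2$ is the abelian $2$-dimensional Lie algebra, acting on $\mathfrak h_3$ by derivations. -/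

import Mathlib

attribute [local instance 100] LieRing.ofAssociativeRing

/-- A Sasakian structure `(Φ, α, ξ, g)` on a real Lie algebra `𝔤`.  Here the exterior derivative of
`α : 𝔤 → ℝ` is the Chevalley–Eilenberg one, `dα(X, Y) = -α([X, Y])`. -/
structure SasakianStructure (𝔤 : Type*) [LieRing 𝔤] [LieAlgebra ℝ 𝔤] where
  /-- the endomorphism -/
  Φ : 𝔤 →ₗ[ℝ] 𝔤
  /-- the contact form -/
  α : 𝔤 →ₗ[ℝ] ℝ
  /-- the Reeb vector -/
  ξ : 𝔤
  /-- the inner product -/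
  g : 𝔤 →ₗ[ℝ] 𝔤 →ₗ[ℝ] ℝ
  g_symm : ∀ X Y, g X Y = g Y X
  g_pos : ∀ X, X ≠ 0 → 0 < g X X
  α_ξ : α ξ = 1
  Φ_sq : ∀ X, Φ (Φ X) = -X + α X • ξ
  compatible : ∀ X Y, g (Φ X) (Φ Y) = g X Y - α X * α Y
  /-- `2 g(X, ΦY) = dα(X, Y)` -/
  contact_metric : ∀ X Y, 2 * g X (Φ Y) = -α ⁅X, Y⁆
  /-- `N_Φ(X, Y) = -dα(X, Y) ξ` -/
  normal : ∀ X Y, Φ (Φ ⁅X, Y⁆) + ⁅Φ X, Φ Y⁆ - Φ ⁅Φ X, Y⁆ - Φ ⁅X, Φ Y⁆ = -((-α ⁅X, Y⁆) • ξ)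

/-- A Lie algebra is unimodular if `tr (ad X) = 0` for all `X`. -/
def IsUnimodularLie (𝔤 : Type*) [LieRing 𝔤] [LieAlgebra ℝ 𝔤] : Prop :=
  ∀ X : 𝔤, LinearMap.trace ℝ 𝔤 (LieAlgebra.ad ℝ 𝔤 X) = 0

/-- `𝔰𝔩(2, ℝ)`: real `2 × 2` matrices of trace zero. -/
abbrev SL2Lie : LieSubalgebra ℝ (Matrix (Fin 2) (Fin 2) ℝ) :=
  LieAlgebra.SpecialLinear.sl (Fin 2) ℝ

/-- `𝔰𝔲(2)`: complex skew-Hermitian `2 × 2` matrices of trace zero, as a real Lie algebra. -/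
def SU2Lie : LieSubalgebra ℝ (Matrix (Fin 2) (Fin 2) ℂ) where
  carrier := {A | A.conjTranspose = -A ∧ A.trace = 0}
  add_mem' := by
    rintro A B ⟨hA, hA'⟩ ⟨hB, hB'⟩
    refine ⟨?_, by rw [Matrix.trace_add, hA', hB', add_zero]⟩
    rw [Matrix.conjTranspose_add, hA, hB]
    abel
  zero_mem' := by simp
  smul_mem' := by
    rintro c A ⟨hA, hA'⟩
    refine ⟨?_, by rw [Matrix.trace_smul, hA', smul_zero]⟩
    rw [Matrix.conjTranspose_smul, hA, star_trivial, smul_neg]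
  lie_mem' := by
    rintro A B ⟨hA, _⟩ ⟨hB, _⟩
    refine ⟨?_, ?_⟩
    · rw [Ring.lie_def, Matrix.conjTranspose_sub, Matrix.conjTranspose_mul,
        Matrix.conjTranspose_mul, hA, hB]
      noncomm_ring
    · rw [Ring.lie_def, Matrix.trace_sub, Matrix.trace_mul_comm, sub_self]

/-- `𝔞𝔣𝔣(ℝ)`, the Lie algebra of the group of affine motions `x ↦ a x + b` of `ℝ`: the matrices
`!![a, b; 0, 0]`. -/
def AffLie : LieSubalgebra ℝ (Matrix (Fin 2) (Fin 2) ℝ) where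
  carrier := {A | ∀ j, A 1 j = 0}
  add_mem' := by
    intro A B hA hB j
    simp [hA j, hB j]
  zero_mem' := by
    intro j
    rfl
  smul_mem' := by
    intro c A hA j
    simp [hA j]
  lie_mem' := by
    intro A B hA hB j
    simp [Ring.lie_def, Matrix.mul_apply, hA 0, hA 1, hB 0, hB 1]

/-- The Heisenberg Lie algebra `𝔥₃` with basis `X, Y, Z` and the only non-zero bracket
`[X, Y] = Z`, in coordinates with respect to this basis. -/
def Heis3 : Type := Fin 3 → ℝ

noncomputable section

instance : AddCommGroup Heis3 := inferInstanceAs (AddCommGroup (Fin 3 → ℝ))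

instance : Module ℝ Heis3 := inferInstanceAs (Module ℝ (Fin 3 → ℝ))

theorem Heis3.ext {x y : Heis3} (h0 : x 0 = y 0) (h1 : x 1 = y 1) (h2 : x 2 = y 2) : x = y := by
  funext i
  fin_cases i
  · exact h0
  · exact h1
  · exact h2

theorem Heis3.add_apply (x y : Heis3) (i : Fin 3) : (x + y) i = x i + y i := rfl

theorem Heis3.smul_apply (c : ℝ) (x : Heis3) (i : Fin 3) : (c • x) i = c * x i := rfl

theorem Heis3.zero_apply (i : Fin 3) : (0 : Heis3) i = 0 := rfl

instance : Bracket Heis3 Heis3 where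
  bracket x y := ![0, 0, x 0 * y 1 - x 1 * y 0]

theorem Heis3.lie_zero_coord (x y : Heis3) : ⁅x, y⁆ 0 = 0 := rfl

theorem Heis3.lie_one_coord (x y : Heis3) : ⁅x, y⁆ 1 = 0 := rfl

theorem Heis3.lie_two_coord (x y : Heis3) : ⁅x, y⁆ 2 = x 0 * y 1 - x 1 * y 0 := rfl

instance : LieRing Heis3 where
  add_lie x y z := by
    apply Heis3.ext <;>
      simp only [Heis3.add_apply, Heis3.lie_zero_coord, Heis3.lie_one_coord,
        Heis3.lie_two_coord] <;> ring
  lie_add x y z := by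
    apply Heis3.ext <;>
      simp only [Heis3.add_apply, Heis3.lie_zero_coord, Heis3.lie_one_coord,
        Heis3.lie_two_coord] <;> ring
  lie_self x := by
    apply Heis3.ext <;>
      simp only [Heis3.zero_apply, Heis3.lie_zero_coord, Heis3.lie_one_coord,
        Heis3.lie_two_coord] <;> ring
  leibniz_lie x y z := by
    apply Heis3.ext <;>
      simp only [Heis3.add_apply, Heis3.lie_zero_coord, Heis3.lie_one_coord,
        Heis3.lie_two_coord] <;> ring

instance : LieAlgebra ℝ Heis3 where
  lie_smul c x y := by
    apply Heis3.ext <;>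
      simp only [Heis3.smul_apply, Heis3.lie_zero_coord, Heis3.lie_one_coord,
        Heis3.lie_two_coord] <;> ring

/-- The Lie algebra `𝔤₀` with basis `e₁, …, e₅` and brackets
`[e₁,e₃] = e₃`, `[e₁,e₄] = ½ e₄`, `[e₁,e₅] = ½ e₅`, `[e₂,e₄] = e₅`, `[e₂,e₅] = -e₄`,
`[e₄,e₅] = -e₃` (all other brackets of basis vectors `eᵢ, eⱼ` with `i < j` vanish), in coordinates
with respect to this basis; coordinate `i : Fin 5` belongs to `eᵢ₊₁`. -/
def G0 : Type := Fin 5 → ℝ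

instance : AddCommGroup G0 := inferInstanceAs (AddCommGroup (Fin 5 → ℝ))

instance : Module ℝ G0 := inferInstanceAs (Module ℝ (Fin 5 → ℝ))

theorem G0.ext {x y : G0} (h0 : x 0 = y 0) (h1 : x 1 = y 1) (h2 : x 2 = y 2) (h3 : x 3 = y 3)
    (h4 : x 4 = y 4) : x = y := by
  funext i
  fin_cases i
  · exact h0
  · exact h1
  · exact h2
  · exact h3
  · exact h4

theorem G0.add_apply (x y : G0) (i : Fin 5) : (x + y) i = x i + y i := rfl

theorem G0.smul_apply (c : ℝ) (x : G0) (i : Fin 5) : (c • x) i = c * x i := rfl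

theorem G0.neg_apply (x : G0) (i : Fin 5) : (-x) i = -x i := rfl

theorem G0.zero_apply (i : Fin 5) : (0 : G0) i = 0 := rfl

instance : Bracket G0 G0 where
  bracket x y :=
    ![0,
      0,
      (x 0 * y 2 - x 2 * y 0) - (x 3 * y 4 - x 4 * y 3),
      (1 / 2) * (x 0 * y 3 - x 3 * y 0) - (x 1 * y 4 - x 4 * y 1),
      (1 / 2) * (x 0 * y 4 - x 4 * y 0) + (x 1 * y 3 - x 3 * y 1)]

theorem G0.lie_zero_coord (x y : G0) : ⁅x, y⁆ 0 = 0 := rfl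

theorem G0.lie_one_coord (x y : G0) : ⁅x, y⁆ 1 = 0 := rfl

theorem G0.lie_two_coord (x y : G0) :
    ⁅x, y⁆ 2 = (x 0 * y 2 - x 2 * y 0) - (x 3 * y 4 - x 4 * y 3) := rfl

theorem G0.lie_three_coord (x y : G0) :
    ⁅x, y⁆ 3 = (1 / 2) * (x 0 * y 3 - x 3 * y 0) - (x 1 * y 4 - x 4 * y 1) := rfl

theorem G0.lie_four_coord (x y : G0) :
    ⁅x, y⁆ 4 = (1 / 2) * (x 0 * y 4 - x 4 * y 0) + (x 1 * y 3 - x 3 * y 1) := rfl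

instance : LieRing G0 where
  add_lie x y z := by
    apply G0.ext <;>
      simp only [G0.add_apply, G0.lie_zero_coord, G0.lie_one_coord, G0.lie_two_coord,
        G0.lie_three_coord, G0.lie_four_coord] <;> ring
  lie_add x y z := by
    apply G0.ext <;>
      simp only [G0.add_apply, G0.lie_zero_coord, G0.lie_one_coord, G0.lie_two_coord,
        G0.lie_three_coord, G0.lie_four_coord] <;> ring
  lie_self x := by
    apply G0.ext <;>
      simp only [G0.zero_apply, G0.lie_zero_coord, G0.lie_one_coord, G0.lie_two_coord,
        G0.lie_three_coord, G0.lie_four_coord] <;> ring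
  leibniz_lie x y z := by
    apply G0.ext <;>
      simp only [G0.add_apply, G0.lie_zero_coord, G0.lie_one_coord, G0.lie_two_coord,
        G0.lie_three_coord, G0.lie_four_coord] <;> ring

instance : LieAlgebra ℝ G0 where
  lie_smul c x y := by
    apply G0.ext <;>
      simp only [G0.smul_apply, G0.lie_zero_coord, G0.lie_one_coord, G0.lie_two_coord,
        G0.lie_three_coord, G0.lie_four_coord] <;> ring

/-- The basis vector of `𝔤₀` with index `i`; thus `G0.e 0, …, G0.e 4` are `e₁, …, e₅`. -/
def G0.e (i : Fin 5) : G0 := fun j => if j = i then 1 else 0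

theorem G0.e_apply (i j : Fin 5) : G0.e i j = if j = i then 1 else 0 := rfl

/-- The structure equations of `𝔤₀`. -/
theorem G0.structure_equations :
    ⁅G0.e 0, G0.e 1⁆ = 0 ∧
    ⁅G0.e 0, G0.e 2⁆ = G0.e 2 ∧
    ⁅G0.e 0, G0.e 3⁆ = (1 / 2 : ℝ) • G0.e 3 ∧
    ⁅G0.e 0, G0.e 4⁆ = (1 / 2 : ℝ) • G0.e 4 ∧
    ⁅G0.e 1, G0.e 2⁆ = 0 ∧
    ⁅G0.e 1, G0.e 3⁆ = G0.e 4 ∧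
    ⁅G0.e 1, G0.e 4⁆ = -G0.e 3 ∧
    ⁅G0.e 2, G0.e 3⁆ = 0 ∧
    ⁅G0.e 2, G0.e 4⁆ = 0 ∧
    ⁅G0.e 3, G0.e 4⁆ = -G0.e 2 := by
  refine ⟨?_, ?_, ?_, ?_, ?_, ?_, ?_, ?_, ?_, ?_⟩ <;> apply G0.ext <;>
    simp [G0.lie_zero_coord, G0.lie_one_coord, G0.lie_two_coord, G0.lie_three_coord,
      G0.lie_four_coord, G0.e_apply, G0.smul_apply, G0.neg_apply, G0.zero_apply]

end

/-! Let T = -Φ ∘ ad ξ. Normality shows that ad ξ commutes with Φ, the Jacobi identity makes T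
symmetric for g, and T vanishes only if ξ is central. So for trivial center the spectral theorem
gives a frame ξ, e₁, Φe₁, e₃, Φe₃ in which ad ξ rotates two planes, with speeds a ≠ 0 and b
(`exists_frame`).

Brackets add weights of ad ξ. If b ≠ 0, weights and normality leave so few brackets between the two
planes that the Jacobi identity fails; hence b = 0 (`b_eq_zero`). Now f = [e₃, e₄] centralises the
plane of e₁, e₂, and a combination h of e₃, e₄, ξ satisfies [h, f] = f and acts on that plane by a
scalar k, while [e₁, e₂] = (2 - 2d) ξ + d f (`exists_normalForm`). The Jacobi identity for h, e₁, e₂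
leaves (k, d) = (0, 0) or (1/2, 1) (`dichotomy`). In the first case the algebra splits as span(ξ,
e₁, e₂) × span(h, f), and the sign of a decides between 𝔰𝔩(2, ℝ) and 𝔰𝔲(2); the second case is 𝔤₀.
-/

/-- A non-zero endomorphism of a finite-dimensional real vector space which is symmetric with
respect to a positive definite symmetric bilinear form has a non-zero real eigenvalue. -/
theorem exists_eigenvector_of_symmetric {V : Type*} [AddCommGroup V] [Module ℝ V]
    [FiniteDimensional ℝ V] (B : V →ₗ[ℝ] V →ₗ[ℝ] ℝ) (hsymm : ∀ x y, B x y = B y x)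
    (hpos : ∀ x, x ≠ 0 → 0 < B x x) (T : V →ₗ[ℝ] V) (hT : ∀ x y, B (T x) y = B x (T y))
    (h0 : T ≠ 0) : ∃ (c : ℝ) (v : V), c ≠ 0 ∧ v ≠ 0 ∧ T v = c • v := by
  have hnonneg : ∀ x, 0 ≤ B x x := fun x => by
    rcases eq_or_ne x 0 with rfl | hx
    · simp
    · exact (hpos x hx).le
  let core : InnerProductSpace.Core ℝ V :=
    { inner := fun x y => B x y
      conj_inner_symm := fun x y => hsymm y x
      re_inner_nonneg := fun x => hnonneg x
      add_left := fun x y z => by simp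
      smul_left := fun x y r => by simp
      definite := fun x hx => by
        by_contra hne
        exact (hpos x hne).ne' hx }
  let _ : NormedAddCommGroup V := core.toNormedAddCommGroup
  let _ : InnerProductSpace ℝ V := InnerProductSpace.ofCore core.toCore
  have hs : T.IsSymmetric := fun x y => hT x y
  let b := hs.eigenvectorBasis rfl
  -- If every eigenvalue were zero, T would kill an eigenbasis.
  by_contra! hcon
  apply h0
  apply b.toBasis.ext
  intro i
  have hb : T (b i) = hs.eigenvalues rfl i • b i := hs.apply_eigenvectorBasis rfl i
  have hne : b i ≠ 0 := b.orthonormal.ne_zero i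
  have hz : hs.eigenvalues rfl i = 0 := by
    by_contra hc
    exact hcon _ _ hc hne hb
  simp [hb, hz]

/-! ### Linear algebra of a Sasakian structure and the operator -Φ ∘ ad ξ. -/

namespace SasakianStructure

variable {𝔤 : Type*} [LieRing 𝔤] [LieAlgebra ℝ 𝔤] (S : SasakianStructure 𝔤)

theorem ξ_ne_zero : S.ξ ≠ 0 := by
  intro h
  have := S.α_ξ
  simp [h] at this

/-- Since Φ²ξ = 0, the formula for Φ² at Φξ makes Φξ a multiple of ξ; the factor squares to zero. -/
theorem Φ_ξ : S.Φ S.ξ = 0 := by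
  have h2 : S.Φ (S.Φ S.ξ) = 0 := by rw [S.Φ_sq, S.α_ξ]; simp
  have h3 : S.Φ S.ξ = S.α (S.Φ S.ξ) • S.ξ := by
    have := S.Φ_sq (S.Φ S.ξ)
    rw [h2, map_zero] at this
    linear_combination (norm := module) this
  have h4 : S.α (S.Φ S.ξ) • S.α (S.Φ S.ξ) • S.ξ = 0 := by
    rw [← h3, ← map_smul, ← h3, h2]
  have h5 : S.α (S.Φ S.ξ) = 0 := by
    simpa [S.ξ_ne_zero] using h4
  rw [h3, h5, zero_smul]

/-- Compute Φ³X both as Φ(Φ²X) and as Φ²(ΦX): the two differ by α(ΦX) ξ. -/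
theorem α_Φ (X : 𝔤) : S.α (S.Φ X) = 0 := by
  have h := S.Φ_sq (S.Φ X)
  have h1 : S.Φ (S.Φ (S.Φ X)) = -S.Φ X := by
    rw [S.Φ_sq X, map_add, map_neg, map_smul, S.Φ_ξ, smul_zero, add_zero]
  rw [h1, left_eq_add] at h
  simpa [S.ξ_ne_zero] using h

theorem g_ξ (X : 𝔤) : S.g S.ξ X = S.α X := by
  have h := S.compatible S.ξ X
  rw [S.Φ_ξ, S.α_ξ, map_zero, LinearMap.zero_apply, one_mul] at h
  linarith

theorem α_lie_ξ (X : 𝔤) : S.α ⁅S.ξ, X⁆ = 0 := by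
  have h := S.contact_metric S.ξ X
  rw [S.g_ξ, S.α_Φ] at h
  linarith

/-- Normality at the pair (ξ, X) reduces to Φ[ξ, ΦX] = -[ξ, X]; applying Φ once more gives the
claim, because α vanishes on the image of ad ξ. -/
theorem lie_ξ_Φ (X : 𝔤) : ⁅S.ξ, S.Φ X⁆ = S.Φ ⁅S.ξ, X⁆ := by
  have h := S.normal S.ξ X
  rw [S.Φ_ξ, S.α_lie_ξ, zero_lie, zero_lie, map_zero, S.Φ_sq, S.α_lie_ξ, zero_smul] at h
  have h1 : S.Φ ⁅S.ξ, S.Φ X⁆ = -⁅S.ξ, X⁆ := by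
    linear_combination (norm := module) -h
  have h2 := S.Φ_sq ⁅S.ξ, S.Φ X⁆
  rw [h1, S.α_lie_ξ, map_neg, zero_smul, add_zero] at h2
  exact (neg_injective h2).symm

/-- The endomorphism `-Φ ∘ ad ξ`. -/
noncomputable def reebOp : 𝔤 →ₗ[ℝ] 𝔤 := -(S.Φ ∘ₗ (LieAlgebra.ad ℝ 𝔤 S.ξ : 𝔤 →ₗ[ℝ] 𝔤))

theorem reebOp_apply (X : 𝔤) : S.reebOp X = -S.Φ ⁅S.ξ, X⁆ := rfl

theorem Φ_reebOp (X : 𝔤) : S.Φ (S.reebOp X) = ⁅S.ξ, X⁆ := by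
  rw [reebOp_apply, map_neg, S.Φ_sq, S.α_lie_ξ]
  simp

theorem reebOp_Φ (X : 𝔤) : S.reebOp (S.Φ X) = S.Φ (S.reebOp X) := by
  rw [Φ_reebOp, reebOp_apply, lie_ξ_Φ, S.Φ_sq, S.α_lie_ξ]
  simp

theorem α_reebOp (X : 𝔤) : S.α (S.reebOp X) = 0 := by
  rw [reebOp_apply, map_neg, α_Φ, neg_zero]

/-- Here 2 g(U, TV) = α([U, [ξ, V]]), which is symmetric in U and V by the Jacobi identity together
with α ∘ ad ξ = 0. -/
theorem g_reebOp (X Y : 𝔤) : S.g (S.reebOp X) Y = S.g X (S.reebOp Y) := by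
  have key : ∀ U V, 2 * S.g U (S.reebOp V) = S.α ⁅U, ⁅S.ξ, V⁆⁆ := fun U V => by
    rw [reebOp_apply, map_neg, mul_neg, S.contact_metric, neg_neg]
  have hj : S.α ⁅Y, ⁅S.ξ, X⁆⁆ = S.α ⁅X, ⁅S.ξ, Y⁆⁆ := by
    have h := congrArg S.α (leibniz_lie S.ξ X Y)
    rw [S.α_lie_ξ, ← lie_skew, map_add, map_neg] at h
    linarith
  have h1 := key Y X
  have h2 := key X Y
  rw [S.g_symm (S.reebOp X)]
  linarith

theorem reebOp_ne_zero (hc : LieAlgebra.center ℝ 𝔤 = ⊥) : S.reebOp ≠ 0 := by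
  intro h
  apply S.ξ_ne_zero
  rw [← LieSubmodule.mem_bot (R := ℝ) (L := 𝔤), ← hc, LieModule.mem_maxTrivSubmodule]
  intro X
  rw [← lie_skew, ← Φ_reebOp, h]
  simp

theorem g_Φ_self (X : 𝔤) : S.g X (S.Φ X) = 0 := by
  have := S.contact_metric X X
  simp at this
  exact this

theorem g_Φ_left (X Y : 𝔤) : S.g (S.Φ X) Y = -S.g X (S.Φ Y) := by
  have h1 := S.contact_metric Y X
  have h2 := S.contact_metric X Y
  rw [← lie_skew, map_neg] at h2
  rw [S.g_symm]
  linarith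

/-! ### Adapted frames. -/

theorem exists_normalize {X : 𝔤} (hX : X ≠ 0) : ∃ c : ℝ, S.g (c • X) (c • X) = 1 := by
  have h := S.g_pos X hX
  refine ⟨(√(S.g X X))⁻¹, ?_⟩
  simp only [map_smul, LinearMap.smul_apply, smul_eq_mul]
  field_simp
  exact (Real.sq_sqrt h.le).symm

/-- A `Φ`-adapted frame of a five-dimensional Sasakian Lie algebra that diagonalises
`-Φ ∘ ad ξ` with eigenvalues `0, a, a, b, b`. -/
structure Frame (S : SasakianStructure 𝔤) (a b : ℝ) where
  e₁ : 𝔤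
  e₂ : 𝔤
  e₃ : 𝔤
  e₄ : 𝔤
  Φ_e₁ : S.Φ e₁ = e₂
  Φ_e₂ : S.Φ e₂ = -e₁
  Φ_e₃ : S.Φ e₃ = e₄
  Φ_e₄ : S.Φ e₄ = -e₃
  ξ_e₁ : ⁅S.ξ, e₁⁆ = a • e₂
  ξ_e₂ : ⁅S.ξ, e₂⁆ = -(a • e₁)
  ξ_e₃ : ⁅S.ξ, e₃⁆ = b • e₄
  ξ_e₄ : ⁅S.ξ, e₄⁆ = -(b • e₃)
  α_e₁₂ : S.α ⁅e₁, e₂⁆ = 2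
  α_e₁₃ : S.α ⁅e₁, e₃⁆ = 0
  α_e₁₄ : S.α ⁅e₁, e₄⁆ = 0
  α_e₂₃ : S.α ⁅e₂, e₃⁆ = 0
  α_e₂₄ : S.α ⁅e₂, e₄⁆ = 0
  α_e₃₄ : S.α ⁅e₃, e₄⁆ = 2
  indep : ∀ {c₀ c₁ c₂ c₃ c₄ : ℝ},
    c₀ • S.ξ + c₁ • e₁ + c₂ • e₂ + c₃ • e₃ + c₄ • e₄ = 0 →
      c₀ = 0 ∧ c₁ = 0 ∧ c₂ = 0 ∧ c₃ = 0 ∧ c₄ = 0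
  span : ∀ X : 𝔤, ∃ c₁ c₂ c₃ c₄ : ℝ,
    X = S.α X • S.ξ + c₁ • e₁ + c₂ • e₂ + c₃ • e₃ + c₄ • e₄

theorem span_of_indep [FiniteDimensional ℝ 𝔤] (h5 : Module.finrank ℝ 𝔤 = 5) {v₀ v₁ v₂ v₃ v₄ : 𝔤}
    (h : ∀ {c₀ c₁ c₂ c₃ c₄ : ℝ},
      c₀ • v₀ + c₁ • v₁ + c₂ • v₂ + c₃ • v₃ + c₄ • v₄ = 0 →
        c₀ = 0 ∧ c₁ = 0 ∧ c₂ = 0 ∧ c₃ = 0 ∧ c₄ = 0) (X : 𝔤) :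
    ∃ c₀ c₁ c₂ c₃ c₄ : ℝ, X = c₀ • v₀ + c₁ • v₁ + c₂ • v₂ + c₃ • v₃ + c₄ • v₄ := by
  have hli : LinearIndependent ℝ ![v₀, v₁, v₂, v₃, v₄] := by
    rw [Fintype.linearIndependent_iff]
    intro c hc i
    obtain ⟨h0, h1, h2, h3, h4⟩ := h (by simpa [Fin.sum_univ_five] using hc)
    fin_cases i <;> assumption
  let B := basisOfLinearIndependentOfCardEqFinrank hli (by simp [h5])
  refine ⟨B.repr X 0, B.repr X 1, B.repr X 2, B.repr X 3, B.repr X 4, ?_⟩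
  have hB : ⇑B = ![v₀, v₁, v₂, v₃, v₄] := coe_basisOfLinearIndependentOfCardEqFinrank hli _
  have hX := B.sum_repr X
  rw [Fin.sum_univ_five, hB] at hX
  exact hX.symm

theorem exists_frame (h5 : Module.finrank ℝ 𝔤 = 5) (hc : LieAlgebra.center ℝ 𝔤 = ⊥) :
    ∃ a b : ℝ, a ≠ 0 ∧ Nonempty (S.Frame a b) := by
  have : FiniteDimensional ℝ 𝔤 := Module.finite_of_finrank_pos (by omega)
  obtain ⟨a, v', ha, hv', hTv'⟩ := exists_eigenvector_of_symmetric S.g S.g_symm S.g_pos S.reebOp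
    S.g_reebOp (S.reebOp_ne_zero hc)
  obtain ⟨r, hvv⟩ := S.exists_normalize hv'
  obtain ⟨v, hv⟩ : ∃ v, v = r • v' := ⟨_, rfl⟩
  have hTv : S.reebOp v = a • v := by rw [hv, map_smul, hTv', smul_comm]
  rw [← hv] at hvv
  have hαv : S.α v = 0 := by
    have := S.α_reebOp v
    rw [hTv, map_smul, smul_eq_mul] at this
    exact (mul_eq_zero.mp this).resolve_left ha
  -- Three linear conditions on a space of dimension five have a non-zero common solution.
  obtain ⟨w', hw', hw'0⟩ : ∃ w' ∈ LinearMap.ker (S.α.prod ((S.g v).prod (S.g (S.Φ v)))), w' ≠ 0 := by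
    apply Submodule.exists_mem_ne_zero_of_ne_bot
    apply LinearMap.ker_ne_bot_of_finrank_lt
    simp [h5]
  obtain ⟨q, hww⟩ := S.exists_normalize hw'0
  obtain ⟨w, hw⟩ : ∃ w, w = q • w' := ⟨_, rfl⟩
  rw [← hw] at hww
  obtain ⟨h1w, h2w, h3w⟩ : S.α w' = 0 ∧ S.g v w' = 0 ∧ S.g (S.Φ v) w' = 0 := by
    simpa [Function.prod] using hw'
  have hαw : S.α w = 0 := by simp [hw, h1w]
  have hvw : S.g v w = 0 := by simp [hw, h2w]
  have hΦvw : S.g (S.Φ v) w = 0 := by simp [hw, h3w]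
  have hvΦw : S.g v (S.Φ w) = 0 := by
    have := S.g_Φ_left v w
    linarith
  have hΦΦv : S.Φ (S.Φ v) = -v := by rw [S.Φ_sq, hαv]; simp
  have hΦΦw : S.Φ (S.Φ w) = -w := by rw [S.Φ_sq, hαw]; simp
  have hΦvΦw : S.g (S.Φ v) (S.Φ w) = 0 := by rw [S.compatible, hvw, hαv]; simp
  have hΦvΦv : S.g (S.Φ v) (S.Φ v) = 1 := by rw [S.compatible, hvv, hαv]; simp
  have hΦwΦw : S.g (S.Φ w) (S.Φ w) = 1 := by rw [S.compatible, hww, hαw]; simp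
  have hvΦv := S.g_Φ_self v
  have hwΦw := S.g_Φ_self w
  have coords : ∀ {c₀ c₁ c₂ c₃ c₄ : ℝ} {X : 𝔤},
      X = c₀ • S.ξ + c₁ • v + c₂ • S.Φ v + c₃ • w + c₄ • S.Φ w →
      S.α X = c₀ ∧ S.g v X = c₁ ∧ S.g (S.Φ v) X = c₂ ∧ S.g w X = c₃ ∧ S.g (S.Φ w) X = c₄ := by
    rintro c₀ c₁ c₂ c₃ c₄ X rfl
    have h1 : ∀ Y, S.g Y S.ξ = S.α Y := fun Y => by rw [S.g_symm, S.g_ξ]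
    simp only [map_add, map_smul, smul_eq_mul, S.α_ξ, hαv, hαw, S.α_Φ, h1, hvv, hvw, hvΦw, hvΦv,
      S.g_symm (S.Φ v) v, hΦvΦv, hΦvw, hΦvΦw, S.g_symm w v, S.g_symm w (S.Φ v), hww, hwΦw,
      S.g_symm (S.Φ w) v, S.g_symm (S.Φ w) (S.Φ v), S.g_symm (S.Φ w) w, hΦwΦw]
    simp
  have indep : ∀ {c₀ c₁ c₂ c₃ c₄ : ℝ},
      c₀ • S.ξ + c₁ • v + c₂ • S.Φ v + c₃ • w + c₄ • S.Φ w = 0 →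
        c₀ = 0 ∧ c₁ = 0 ∧ c₂ = 0 ∧ c₃ = 0 ∧ c₄ = 0 := by
    intro c₀ c₁ c₂ c₃ c₄ h
    simpa [eq_comm] using coords h.symm
  have span := span_of_indep h5 indep
  -- No second eigenvector has to be chosen: T preserves the span of w and Φw, which is orthogonal
  -- to ξ, v and Φv. It commutes with the skew map Φ and is symmetric, so g(Φw, Tw) equals its own
  -- negative.
  have hTw : S.reebOp w = S.g w (S.reebOp w) • w := by
    obtain ⟨c₀, c₁, c₂, c₃, c₄, h⟩ := span (S.reebOp w)
    obtain ⟨h0, h1, h2, h3, h4⟩ := coords h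
    rw [S.α_reebOp] at h0
    rw [← S.g_reebOp, hTv, map_smul, LinearMap.smul_apply, hvw, smul_zero] at h1
    rw [← S.g_reebOp, S.reebOp_Φ, hTv, map_smul, map_smul, LinearMap.smul_apply, hΦvw,
      smul_zero] at h2
    have h4' : S.g (S.Φ w) (S.reebOp w) = -S.g (S.Φ w) (S.reebOp w) := by
      conv_lhs => rw [← S.g_reebOp, S.reebOp_Φ, S.g_Φ_left, S.g_symm]
    rw [h3]
    conv_lhs => rw [h]
    have : c₄ = 0 := by linarith
    simp [← h0, ← h1, ← h2, this]
  obtain ⟨b, hb⟩ : ∃ b, b = S.g w (S.reebOp w) := ⟨_, rfl⟩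
  rw [← hb] at hTw
  have hξv : ⁅S.ξ, v⁆ = a • S.Φ v := by rw [← S.Φ_reebOp, hTv, map_smul]
  have hξw : ⁅S.ξ, w⁆ = b • S.Φ w := by rw [← S.Φ_reebOp, hTw, map_smul]
  have hα : ∀ X Y, S.α ⁅X, Y⁆ = -2 * S.g X (S.Φ Y) := fun X Y => by
    linarith [S.contact_metric X Y]
  refine ⟨a, b, ha, ⟨{
    e₁ := v, e₂ := S.Φ v, e₃ := w, e₄ := S.Φ w
    Φ_e₁ := rfl, Φ_e₂ := hΦΦv, Φ_e₃ := rfl, Φ_e₄ := hΦΦw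
    ξ_e₁ := hξv
    ξ_e₂ := by rw [S.lie_ξ_Φ, hξv, map_smul, hΦΦv, smul_neg]
    ξ_e₃ := hξw
    ξ_e₄ := by rw [S.lie_ξ_Φ, hξw, map_smul, hΦΦw, smul_neg]
    α_e₁₂ := by rw [hα, hΦΦv, map_neg, hvv]; norm_num
    α_e₁₃ := by rw [hα, hvΦw]; norm_num
    α_e₁₄ := by rw [hα, hΦΦw, map_neg, hvw]; norm_num
    α_e₂₃ := by rw [hα, hΦvΦw]; norm_num
    α_e₂₄ := by rw [hα, hΦΦw, map_neg, hΦvw]; norm_num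
    α_e₃₄ := by rw [hα, hΦΦw, map_neg, hww]; norm_num
    indep := indep
    span := fun X => ?_ }⟩⟩
  obtain ⟨c₀, c₁, c₂, c₃, c₄, h⟩ := span X
  refine ⟨c₁, c₂, c₃, c₄, ?_⟩
  rw [(coords h).1]
  exact h

end SasakianStructure

/-! ### Structure constants and the reduction to normal form. -/

/-- Five linearly independent vectors `h, f, z, e₁, e₂` of a Lie algebra such that `h, f` span a copy
of `𝔞𝔣𝔣(ℝ)`, `z` rotates the plane of `e₁, e₂`, `h` scales it by `k`, and
`⁅e₁, e₂⁆ = c z + d f`. -/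
structure NormalForm (𝔤 : Type*) [LieRing 𝔤] [LieAlgebra ℝ 𝔤] (a k c d : ℝ) where
  h : 𝔤
  f : 𝔤
  z : 𝔤
  e₁ : 𝔤
  e₂ : 𝔤
  h_f : ⁅h, f⁆ = f
  z_h : ⁅z, h⁆ = 0
  z_f : ⁅z, f⁆ = 0
  h_e₁ : ⁅h, e₁⁆ = k • e₁
  h_e₂ : ⁅h, e₂⁆ = k • e₂
  f_e₁ : ⁅f, e₁⁆ = 0
  f_e₂ : ⁅f, e₂⁆ = 0
  z_e₁ : ⁅z, e₁⁆ = a • e₂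
  z_e₂ : ⁅z, e₂⁆ = -(a • e₁)
  e₁_e₂ : ⁅e₁, e₂⁆ = c • z + d • f
  indep : ∀ {c₀ c₁ c₂ c₃ c₄ : ℝ}, c₀ • h + c₁ • f + c₂ • z + c₃ • e₁ + c₄ • e₂ = 0 →
    c₀ = 0 ∧ c₁ = 0 ∧ c₂ = 0 ∧ c₃ = 0 ∧ c₄ = 0

namespace SasakianStructure

variable {𝔤 : Type*} [LieRing 𝔤] [LieAlgebra ℝ 𝔤] {S : SasakianStructure 𝔤} {a b : ℝ}

namespace Frame

variable (F : S.Frame a b)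


theorem coeff_eq {c₀ c₁ c₂ c₃ c₄ d₀ d₁ d₂ d₃ d₄ : ℝ}
    (h : c₀ • S.ξ + c₁ • F.e₁ + c₂ • F.e₂ + c₃ • F.e₃ + c₄ • F.e₄ =
      d₀ • S.ξ + d₁ • F.e₁ + d₂ • F.e₂ + d₃ • F.e₃ + d₄ • F.e₄) :
    c₀ = d₀ ∧ c₁ = d₁ ∧ c₂ = d₂ ∧ c₃ = d₃ ∧ c₄ = d₄ := by
  have h' : (c₀ - d₀) • S.ξ + (c₁ - d₁) • F.e₁ + (c₂ - d₂) • F.e₂ + (c₃ - d₃) • F.e₃ +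
      (c₄ - d₄) • F.e₄ = 0 := by
    linear_combination (norm := module) h
  simpa [sub_eq_zero] using F.indep h'


theorem e₂_e₁ : ⁅F.e₂, F.e₁⁆ = -⁅F.e₁, F.e₂⁆ := (lie_skew _ _).symm

/-- This is integrability: in the complexification, the bracket of the (-i)-eigenvectors e₁ + i e₂
and e₃ + i e₄ of Φ again lies in the (-i)-eigenspace. -/
theorem normal₁₃ : -⁅F.e₁, F.e₃⁆ + ⁅F.e₂, F.e₄⁆ = S.Φ (⁅F.e₂, F.e₃⁆ + ⁅F.e₁, F.e₄⁆) := by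
  have h := S.normal F.e₁ F.e₃
  rw [S.Φ_sq, F.Φ_e₁, F.Φ_e₃, F.α_e₁₃] at h
  rw [map_add]
  linear_combination (norm := module) h

/-- Coordinates of the brackets of an adapted frame, and the linear equations that normality and the
Jacobi identities involving `ξ` impose on them. -/
theorem exists_coords : ∃ x₁ x₂ x₃ x₄ y₁ y₂ y₃ y₄ p₁ p₂ p₃ p₄ q₁ q₂ q₃ q₄ r₁ r₂ r₃ r₄
    t₁ t₂ t₃ t₄ : ℝ,
    ⁅F.e₁, F.e₂⁆ = (2 : ℝ) • S.ξ + x₁ • F.e₁ + x₂ • F.e₂ + x₃ • F.e₃ + x₄ • F.e₄ ∧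
    ⁅F.e₃, F.e₄⁆ = (2 : ℝ) • S.ξ + y₁ • F.e₁ + y₂ • F.e₂ + y₃ • F.e₃ + y₄ • F.e₄ ∧
    ⁅F.e₁, F.e₃⁆ = (0 : ℝ) • S.ξ + p₁ • F.e₁ + p₂ • F.e₂ + p₃ • F.e₃ + p₄ • F.e₄ ∧
    ⁅F.e₁, F.e₄⁆ = (0 : ℝ) • S.ξ + q₁ • F.e₁ + q₂ • F.e₂ + q₃ • F.e₃ + q₄ • F.e₄ ∧
    ⁅F.e₂, F.e₃⁆ = (0 : ℝ) • S.ξ + r₁ • F.e₁ + r₂ • F.e₂ + r₃ • F.e₃ + r₄ • F.e₄ ∧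
    ⁅F.e₂, F.e₄⁆ = (0 : ℝ) • S.ξ + t₁ • F.e₁ + t₂ • F.e₂ + t₃ • F.e₃ + t₄ • F.e₄ ∧
    (a * x₁ = 0 ∧ a * x₂ = 0 ∧ b * x₃ = 0 ∧ b * x₄ = 0) ∧
    (a * y₁ = 0 ∧ a * y₂ = 0 ∧ b * y₃ = 0 ∧ b * y₄ = 0) ∧
    (-(a * p₂) = a * r₁ + b * q₁ ∧ a * p₁ = a * r₂ + b * q₂ ∧
      -(b * p₄) = a * r₃ + b * q₃ ∧ b * p₃ = a * r₄ + b * q₄) ∧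
    (-(a * q₂) = a * t₁ - b * p₁ ∧ a * q₁ = a * t₂ - b * p₂ ∧
      -(b * q₄) = a * t₃ - b * p₃ ∧ b * q₃ = a * t₄ - b * p₄) ∧
    (-(a * r₂) = -(a * p₁) + b * t₁ ∧ a * r₁ = -(a * p₂) + b * t₂ ∧
      -(b * r₄) = -(a * p₃) + b * t₃ ∧ b * r₃ = -(a * p₄) + b * t₄) ∧
    (-(a * t₂) = -(a * q₁) - b * r₁ ∧ a * t₁ = -(a * q₂) - b * r₂ ∧
      -(b * t₄) = -(a * q₃) - b * r₃ ∧ b * t₃ = -(a * q₄) - b * r₄) ∧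
    (-p₁ + t₁ = -(r₂ + q₂) ∧ -p₂ + t₂ = r₁ + q₁ ∧
      -p₃ + t₃ = -(r₄ + q₄) ∧ -p₄ + t₄ = r₃ + q₃) := by
  obtain ⟨x₁, x₂, x₃, x₄, hx⟩ := F.span ⁅F.e₁, F.e₂⁆
  obtain ⟨y₁, y₂, y₃, y₄, hy⟩ := F.span ⁅F.e₃, F.e₄⁆
  obtain ⟨p₁, p₂, p₃, p₄, hp⟩ := F.span ⁅F.e₁, F.e₃⁆
  obtain ⟨q₁, q₂, q₃, q₄, hq⟩ := F.span ⁅F.e₁, F.e₄⁆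
  obtain ⟨r₁, r₂, r₃, r₄, hr⟩ := F.span ⁅F.e₂, F.e₃⁆
  obtain ⟨t₁, t₂, t₃, t₄, ht⟩ := F.span ⁅F.e₂, F.e₄⁆
  rw [F.α_e₁₂] at hx
  rw [F.α_e₃₄] at hy
  rw [F.α_e₁₃] at hp
  rw [F.α_e₁₄] at hq
  rw [F.α_e₂₃] at hr
  rw [F.α_e₂₄] at ht
  have lin : ∀ c₀ c₁ c₂ c₃ c₄ : ℝ,
      ⁅S.ξ, c₀ • S.ξ + c₁ • F.e₁ + c₂ • F.e₂ + c₃ • F.e₃ + c₄ • F.e₄⁆ =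
        (0 : ℝ) • S.ξ + (-(a * c₂)) • F.e₁ + (a * c₁) • F.e₂ + (-(b * c₄)) • F.e₃ +
          (b * c₃) • F.e₄ := fun c₀ c₁ c₂ c₃ c₄ => by
    simp only [lie_add, lie_smul, lie_self, F.ξ_e₁, F.ξ_e₂, F.ξ_e₃, F.ξ_e₄]
    module
  have jx := leibniz_lie S.ξ F.e₁ F.e₂
  have jy := leibniz_lie S.ξ F.e₃ F.e₄
  have jp := leibniz_lie S.ξ F.e₁ F.e₃
  have jq := leibniz_lie S.ξ F.e₁ F.e₄
  have jr := leibniz_lie S.ξ F.e₂ F.e₃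
  have jt := leibniz_lie S.ξ F.e₂ F.e₄
  have hn := F.normal₁₃
  simp only [F.ξ_e₁, F.ξ_e₂, F.ξ_e₃, F.ξ_e₄, lie_smul, smul_lie, lie_neg, neg_lie, lie_self] at *
  rw [hx, lin] at jx
  rw [hy, lin] at jy
  rw [hp, lin, hr, hq] at jp
  rw [hq, lin, ht, hp] at jq
  rw [hr, lin, hp, ht] at jr
  rw [ht, lin, hq, hr] at jt
  rw [hp, ht, hr, hq] at hn
  simp only [map_add, map_smul, S.Φ_ξ, F.Φ_e₁, F.Φ_e₂, F.Φ_e₃, F.Φ_e₄] at hn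
  refine ⟨x₁, x₂, x₃, x₄, y₁, y₂, y₃, y₄, p₁, p₂, p₃, p₄, q₁, q₂, q₃, q₄, r₁, r₂, r₃, r₄,
    t₁, t₂, t₃, t₄, hx, hy, hp, hq, hr, ht, ?_, ?_, ?_, ?_, ?_, ?_, ?_⟩
  · have := F.coeff_eq (d₀ := 0) (d₁ := 0) (d₂ := 0) (d₃ := 0) (d₄ := 0)
      (jx.trans (by module))
    grind
  · have := F.coeff_eq (d₀ := 0) (d₁ := 0) (d₂ := 0) (d₃ := 0) (d₄ := 0)
      (jy.trans (by module))
    grind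
  · exact (F.coeff_eq (d₀ := 0) (jp.trans (by module))).2
  · exact (F.coeff_eq (d₀ := 0) (jq.trans (by module))).2
  · exact (F.coeff_eq (d₀ := 0) (jr.trans (by module))).2
  · exact (F.coeff_eq (d₀ := 0) (jt.trans (by module))).2
  · refine (F.coeff_eq (c₀ := 0) (d₀ := 0) ?_).2
    linear_combination (norm := module) hn

/-- Suppose b ≠ 0. Write u = e₁ + i e₂ and w = e₃ + i e₄, of ad ξ-weights -ia and -ib. By
integrability [u, w] is a combination of u and w, but its weight is -i(a + b), so it is zero. The
remaining mixed bracket [u, w̄] has weight i(b - a), so it lies in one plane only; each possibility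
contradicts a Jacobi identity. -/
theorem b_eq_zero (F : S.Frame a b) (ha : a ≠ 0) : b = 0 := by
  by_contra hb
  obtain ⟨x₁, x₂, x₃, x₄, y₁, y₂, y₃, y₄, p₁, p₂, p₃, p₄, q₁, q₂, q₃, q₄, r₁, r₂, r₃, r₄,
    t₁, t₂, t₃, t₄, hx, hy, hp, hq, hr, ht, jx, jy, jp, jq, jr, jt, hn⟩ := F.exists_coords
  -- As a and b are non-zero, the weight-zero brackets [e₁, e₂] and [e₃, e₄] both reduce to 2ξ.
  simp only [mul_eq_zero, ha, hb, false_or] at jx jy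
  obtain ⟨rfl, rfl, rfl, rfl⟩ := jx
  obtain ⟨rfl, rfl, rfl, rfl⟩ := jy
  -- This and the next four equations say that [e₁ + i e₂, e₃ + i e₄] = 0.
  obtain ⟨ht₁, ht₂, ht₃, ht₄⟩ : t₁ = p₁ ∧ t₂ = p₂ ∧ t₃ = p₃ ∧ t₄ = p₄ := by
    refine ⟨?_, ?_, ?_, ?_⟩ <;> grind
  obtain ⟨hr₁, hr₂, hr₃, hr₄⟩ : r₁ = -q₁ ∧ r₂ = -q₂ ∧ r₃ = -q₃ ∧ r₄ = -q₄ := by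
    refine ⟨?_, ?_, ?_, ?_⟩ <;> grind
  have hT : ⁅F.e₂, F.e₄⁆ = ⁅F.e₁, F.e₃⁆ := by rw [ht, hp, ht₁, ht₂, ht₃, ht₄]
  have hR : ⁅F.e₂, F.e₃⁆ = -⁅F.e₁, F.e₄⁆ := by rw [hr, hq, hr₁, hr₂, hr₃, hr₄]; module
  -- The left sides of `j₁` and `j₂` come from [2ξ, e₃] and [2ξ, e₁].
  have j₁ : (2 * b) • F.e₄ = (2 * p₁ - 2 * q₂) • S.ξ - (q₃ + p₄) • ⁅F.e₁, F.e₃⁆ +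
      (p₃ - q₄) • ⁅F.e₁, F.e₄⁆ := by
    have j := leibniz_lie F.e₁ F.e₂ F.e₃
    rw [hR, lie_neg] at j
    rw [hp, hq, hx] at j
    simp only [lie_add, lie_smul, lie_self, add_lie, smul_lie, F.ξ_e₃, F.e₂_e₁, hT, hR, zero_smul,
      zero_lie, zero_add] at j
    rw [hx] at j
    linear_combination (norm := module) -j
  have j₂ : (2 * a) • F.e₂ = (-2 * q₄ - 2 * p₃) • S.ξ + (q₁ - p₂) • ⁅F.e₁, F.e₃⁆ -
      (q₂ + p₁) • ⁅F.e₁, F.e₄⁆ := by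
    have j := leibniz_lie F.e₃ F.e₄ F.e₁
    rw [← lie_skew F.e₄ F.e₁, ← lie_skew F.e₃ F.e₁, hp, hq, hy] at j
    simp only [lie_add, lie_smul, lie_self, lie_neg, add_lie, smul_lie, F.ξ_e₁, zero_smul,
      zero_lie, zero_add] at j
    rw [← lie_skew F.e₃ F.e₁, ← lie_skew F.e₃ F.e₂, ← lie_skew F.e₄ F.e₁, ← lie_skew F.e₄ F.e₂,
      ← lie_skew F.e₄ F.e₃, hT, hR, hy] at j
    linear_combination (norm := module) -j
  rw [hp, hq] at j₁ j₂
  obtain ⟨-, -, -, -, k₁⟩ := F.coeff_eq (c₀ := 0) (c₁ := 0) (c₂ := 0) (c₃ := 0) (c₄ := 2 * b)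
    (d₀ := 2 * p₁ - 2 * q₂) (d₁ := -(q₃ + p₄) * p₁ + (p₃ - q₄) * q₁)
    (d₂ := -(q₃ + p₄) * p₂ + (p₃ - q₄) * q₂) (d₃ := -(q₃ + p₄) * p₃ + (p₃ - q₄) * q₃)
    (d₄ := -(q₃ + p₄) * p₄ + (p₃ - q₄) * q₄) (by linear_combination (norm := module) j₁)
  obtain ⟨-, -, k₂, -, -⟩ := F.coeff_eq (c₀ := 0) (c₁ := 0) (c₂ := 2 * a) (c₃ := 0) (c₄ := 0)
    (d₀ := -2 * q₄ - 2 * p₃) (d₁ := (q₁ - p₂) * p₁ - (q₂ + p₁) * q₁)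
    (d₂ := (q₁ - p₂) * p₂ - (q₂ + p₁) * q₂) (d₃ := (q₁ - p₂) * p₃ - (q₂ + p₁) * q₃)
    (d₄ := (q₁ - p₂) * p₄ - (q₂ + p₁) * q₄) (by linear_combination (norm := module) j₂)
  subst ht₁ ht₂ ht₃ ht₄ hr₁ hr₂ hr₃ hr₄
  -- If b = 2a, the mixed brackets have no component along e₃, e₄, so the e₄-coefficient of `j₁`
  -- reads 2b = 0. Otherwise they have none along e₁, e₂, and the e₂-coefficient of `j₂` reads 2a =
  -- 0.
  rcases eq_or_ne b (2 * a) with h | h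
  · have hp₃ : t₃ = 0 := by grind
    have hp₄ : t₄ = 0 := by grind
    have hq₃ : q₃ = 0 := by grind
    have hq₄ : q₄ = 0 := by grind
    simp [hp₃, hp₄, hq₃, hq₄, hb] at k₁
  · have hp₁ : t₁ = 0 := by grind
    have hp₂ : t₂ = 0 := by grind
    have hq₁ : q₁ = 0 := by grind
    have hq₂ : q₂ = 0 := by grind
    simp [hp₁, hp₂, hq₁, hq₂, ha] at k₂

/-- A Sasakian structure with an adapted frame for `b = 0` puts the Lie algebra in normal form. -/
theorem exists_normalForm (F : S.Frame a 0) (ha : a ≠ 0) :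
    ∃ k d : ℝ, Nonempty (NormalForm 𝔤 a k (2 - 2 * d) d) := by
  obtain ⟨x₁, x₂, x₃, x₄, y₁, y₂, s, t, p₁, p₂, p₃, p₄, q₁, q₂, q₃, q₄, r₁, r₂, r₃, r₄,
    t₁, t₂, t₃, t₄, hx, hy, hp, hq, hr, ht, jx, jy, jp, jq, jr, jt, hn⟩ := F.exists_coords
  simp only [zero_mul, neg_zero, add_zero, sub_zero] at jx jy jp jq jr jt
  obtain ⟨rfl, rfl⟩ : x₁ = 0 ∧ x₂ = 0 := by grind
  obtain ⟨rfl, rfl⟩ : y₁ = 0 ∧ y₂ = 0 := by grind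
  -- With b = 0, ad ξ kills e₃ and e₄, so mixed brackets stay in the plane of e₁, e₂, on which ad e₃
  -- and ad e₄ commute with the rotation ad ξ.
  obtain ⟨rfl, rfl, rfl, rfl⟩ : p₃ = 0 ∧ p₄ = 0 ∧ q₃ = 0 ∧ q₄ = 0 := by
    refine ⟨?_, ?_, ?_, ?_⟩ <;> grind
  obtain ⟨rfl, rfl, rfl, rfl⟩ : r₁ = -p₂ ∧ p₁ = r₂ ∧ r₃ = 0 ∧ r₄ = 0 := by
    refine ⟨?_, ?_, ?_, ?_⟩ <;> grind
  obtain ⟨rfl, rfl, rfl, rfl⟩ : t₁ = -q₂ ∧ q₁ = t₂ ∧ t₃ = 0 ∧ t₄ = 0 := by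
    refine ⟨?_, ?_, ?_, ?_⟩ <;> grind
  clear jx jy jp jq jr jt hn
  simp only [zero_smul, zero_add, add_zero] at hx hy hp hq hr ht
  have h31 : ⁅F.e₃, F.e₁⁆ = -⁅F.e₁, F.e₃⁆ := (lie_skew _ _).symm
  have h41 : ⁅F.e₄, F.e₁⁆ = -⁅F.e₁, F.e₄⁆ := (lie_skew _ _).symm
  have h32 : ⁅F.e₃, F.e₂⁆ = -⁅F.e₂, F.e₃⁆ := (lie_skew _ _).symm
  have h42 : ⁅F.e₄, F.e₂⁆ = -⁅F.e₂, F.e₄⁆ := (lie_skew _ _).symm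
  have h43 : ⁅F.e₄, F.e₃⁆ = -⁅F.e₃, F.e₄⁆ := (lie_skew _ _).symm
  have hξ3 : ⁅S.ξ, F.e₃⁆ = 0 := by rw [F.ξ_e₃, zero_smul]
  have hξ4 : ⁅S.ξ, F.e₄⁆ = 0 := by rw [F.ξ_e₄, zero_smul, neg_zero]
  -- On the plane, f = [e₃, e₄] acts as the commutator of two maps commuting with a rotation, that
  -- is, of two complex scalars.
  have hf₁ : ⁅⁅F.e₃, F.e₄⁆, F.e₁⁆ = 0 := by
    rw [lie_lie, h41, h31, hp, hq]
    simp only [lie_neg, lie_add, lie_smul, h31, h32, h41, h42, hp, hq, hr, ht]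
    module
  have hf₂ : ⁅⁅F.e₃, F.e₄⁆, F.e₂⁆ = 0 := by
    rw [lie_lie, h42, h32, hr, ht]
    simp only [lie_neg, lie_add, lie_smul, h31, h32, h41, h42, hp, hq, hr, ht]
    module
  -- The e₂-coefficient of [f, e₁] = 0: since f = 2ξ + s e₃ + t e₄, the part s e₃ + t e₄ must cancel
  -- the rotation 2a, so (s, t) ≠ 0.
  obtain ⟨-, -, hst, -, -⟩ := F.coeff_eq (c₀ := 0) (c₁ := -(s * p₁ + t * q₁))
    (c₂ := 2 * a - (s * p₂ + t * q₂)) (c₃ := 0) (c₄ := 0)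
    (d₀ := 0) (d₁ := 0) (d₂ := 0) (d₃ := 0) (d₄ := 0) (by
      have h := hf₁
      simp only [hy, add_lie, smul_lie, F.ξ_e₁, h31, h41, hp, hq] at h
      linear_combination (norm := module) h)
  have hρ : s * s + t * t ≠ 0 := by
    intro h
    have hs : s = 0 := by nlinarith [mul_self_nonneg s, mul_self_nonneg t]
    have ht : t = 0 := by nlinarith [mul_self_nonneg s, mul_self_nonneg t]
    simp [hs, ht, ha] at hst
  obtain ⟨τ, hτ⟩ : ∃ τ, τ * (s * s + t * t) = 1 := ⟨_, inv_mul_cancel₀ hρ⟩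
  have hf₃ : ⁅⁅F.e₃, F.e₄⁆, F.e₃⁆ = -(t • ⁅F.e₃, F.e₄⁆) := by
    conv_lhs => rw [hy]
    simp only [add_lie, smul_lie, hξ3, lie_self, h43]
    module
  have hf₄ : ⁅⁅F.e₃, F.e₄⁆, F.e₄⁆ = s • ⁅F.e₃, F.e₄⁆ := by
    conv_lhs => rw [hy]
    simp only [add_lie, smul_lie, hξ4, lie_self]
    module
  have hξf : ⁅S.ξ, ⁅F.e₃, F.e₄⁆⁆ = 0 := by
    rw [hy]
    simp only [lie_add, lie_smul, hξ3, hξ4, lie_self]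
    module
  have hfξ : ⁅⁅F.e₃, F.e₄⁆, S.ξ⁆ = 0 := by rw [← lie_skew, hξf, neg_zero]
  -- Since f kills e₁ and e₂, it kills [e₁, e₂]; this makes (x₃, x₄) proportional to (s, t), with
  -- factor d.
  have hx34 : s * x₄ = t * x₃ := by
    have h := leibniz_lie ⁅F.e₃, F.e₄⁆ F.e₁ F.e₂
    rw [hf₁, hf₂, hx] at h
    simp only [lie_add, lie_smul, hf₃, hf₄, hfξ, zero_lie, lie_zero] at h
    rw [hy] at h
    obtain ⟨h', -⟩ := F.coeff_eq (c₀ := 2 * (s * x₄ - t * x₃)) (c₁ := 0) (c₂ := 0)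
      (c₃ := (s * x₄ - t * x₃) * s) (c₄ := (s * x₄ - t * x₃) * t) (d₀ := 0) (d₁ := 0) (d₂ := 0)
      (d₃ := 0) (d₄ := 0) (by linear_combination (norm := module) h)
    linarith
  have hx₃ : x₃ = τ * (s * x₃ + t * x₄) * s := by
    linear_combination (-x₃) * hτ - τ * t * hx34
  have hx₄ : x₄ = τ * (s * x₃ + t * x₄) * t := by
    linear_combination (-x₄) * hτ + τ * s * hx34
  obtain ⟨d, hd⟩ : ∃ d, d = τ * (s * x₃ + t * x₄) := ⟨_, rfl⟩
  rw [← hd] at hx₃ hx₄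
  -- Subtracting m ξ removes the rotational part of (τ t) e₃ - (τ s) e₄ on the plane and leaves the
  -- scalar k; ξ commutes with f, so [h, f] = f is unaffected.
  obtain ⟨m, hm⟩ : ∃ m, m * a = τ * s * q₂ - τ * t * p₂ := ⟨_, div_mul_cancel₀ _ ha⟩
  refine ⟨τ * s * q₁ - τ * t * p₁, d, ⟨{
    h := (τ * t) • F.e₃ - (τ * s) • F.e₄ - m • S.ξ
    f := ⁅F.e₃, F.e₄⁆
    z := S.ξ
    e₁ := F.e₁
    e₂ := F.e₂
    h_f := ?_
    z_h := by simp [hξ3, hξ4]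
    z_f := hξf
    h_e₁ := ?_
    h_e₂ := ?_
    f_e₁ := hf₁
    f_e₂ := hf₂
    z_e₁ := F.ξ_e₁
    z_e₂ := F.ξ_e₂
    e₁_e₂ := ?_
    indep := ?_ }⟩⟩
  · have h : ⁅⁅F.e₃, F.e₄⁆, (τ * t) • F.e₃ - (τ * s) • F.e₄ - m • S.ξ⁆ =
        (-(τ * (s * s + t * t))) • ⁅F.e₃, F.e₄⁆ := by
      simp only [lie_sub, lie_smul, hf₃, hf₄, hfξ]
      module
    rw [← lie_skew, h, hτ]
    module
  · simp only [sub_lie, smul_lie, h31, h41, hp, hq, F.ξ_e₁]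
    have hm' : (m * a) • F.e₂ = (τ * s * q₂ - τ * t * p₂) • F.e₂ := by rw [hm]
    linear_combination (norm := module) -hm'
  · simp only [sub_lie, smul_lie, h32, h42, hr, ht, F.ξ_e₂]
    have hm' : (m * a) • F.e₁ = (τ * s * q₂ - τ * t * p₂) • F.e₁ := by rw [hm]
    linear_combination (norm := module) hm'
  -- Since s e₃ + t e₄ = f - 2ξ, the bracket is 2ξ + d (f - 2ξ); hence the coefficient 2 - 2d.
  · rw [hx, hy, hx₃, hx₄]
    module
  · intro c₀ c₁ c₂ c₃ c₄ h
    rw [hy] at h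
    obtain ⟨h0, h1, h2, h3, h4⟩ := F.indep (c₀ := c₂ + 2 * c₁ - c₀ * m) (c₁ := c₃) (c₂ := c₄)
      (c₃ := c₀ * (τ * t) + c₁ * s) (c₄ := c₁ * t - c₀ * (τ * s))
      (by linear_combination (norm := module) h)
    have hc₀ : c₀ = 0 := by linear_combination t * h3 - s * h4 - c₀ * hτ
    have hc₁ : c₁ = 0 := by linear_combination τ * s * h3 + τ * t * h4 - c₁ * hτ
    subst hc₀ hc₁
    exact ⟨rfl, rfl, by linarith, h1, h2⟩

end Frame
end SasakianStructure

/-- By the Jacobi identity [e₁, e₂] has ad h-weight 2k, while z has weight 0 and f weight 1. So d =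
2kd and k(1 - d) = 0. -/
theorem NormalForm.dichotomy {𝔤 : Type*} [LieRing 𝔤] [LieAlgebra ℝ 𝔤] {a k d : ℝ}
    (N : NormalForm 𝔤 a k (2 - 2 * d) d) : k = 0 ∧ d = 0 ∨ k = 1 / 2 ∧ d = 1 := by
  have h := leibniz_lie N.h N.e₁ N.e₂
  have hz : ⁅N.h, N.z⁆ = 0 := by rw [← lie_skew, N.z_h, neg_zero]
  rw [N.h_e₁, N.h_e₂, smul_lie, lie_smul, N.e₁_e₂, lie_add, lie_smul, lie_smul, hz, N.h_f] at h
  obtain ⟨-, h1, h2, -, -⟩ := N.indep (c₀ := 0) (c₁ := d - 2 * k * d)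
    (c₂ := -(2 * k * (2 - 2 * d))) (c₃ := 0) (c₄ := 0) (by linear_combination (norm := module) h)
  have h3 : k * (2 * k - 1) = 0 := by linear_combination h2 / 4 - k * (h1 + h2 / 2)
  grind

/-! ### Recognising the normal forms from coordinates. -/

namespace NormalForm

variable {𝔤 : Type*} [LieRing 𝔤] [LieAlgebra ℝ 𝔤] {a k c d : ℝ}

theorem lie_combination (N : NormalForm 𝔤 a k c d) (u₀ u₁ u₂ u₃ u₄ v₀ v₁ v₂ v₃ v₄ : ℝ) :
    ⁅u₀ • N.h + u₁ • N.f + u₂ • N.z + u₃ • N.e₁ + u₄ • N.e₂,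
      v₀ • N.h + v₁ • N.f + v₂ • N.z + v₃ • N.e₁ + v₄ • N.e₂⁆ =
    (0 : ℝ) • N.h + (u₀ * v₁ - u₁ * v₀ + d * (u₃ * v₄ - u₄ * v₃)) • N.f +
      (c * (u₃ * v₄ - u₄ * v₃)) • N.z +
      (k * (u₀ * v₃ - u₃ * v₀) - a * (u₂ * v₄ - u₄ * v₂)) • N.e₁ +
      (k * (u₀ * v₄ - u₄ * v₀) + a * (u₂ * v₃ - u₃ * v₂)) • N.e₂ := by
  have hzh : ⁅N.h, N.z⁆ = 0 := by rw [← lie_skew, N.z_h, neg_zero]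
  have hzf : ⁅N.f, N.z⁆ = 0 := by rw [← lie_skew, N.z_f, neg_zero]
  have hfh : ⁅N.f, N.h⁆ = -N.f := by rw [← lie_skew, N.h_f]
  have he₁h : ⁅N.e₁, N.h⁆ = -(k • N.e₁) := by rw [← lie_skew, N.h_e₁]
  have he₂h : ⁅N.e₂, N.h⁆ = -(k • N.e₂) := by rw [← lie_skew, N.h_e₂]
  have he₁f : ⁅N.e₁, N.f⁆ = 0 := by rw [← lie_skew, N.f_e₁, neg_zero]
  have he₂f : ⁅N.e₂, N.f⁆ = 0 := by rw [← lie_skew, N.f_e₂, neg_zero]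
  have he₁z : ⁅N.e₁, N.z⁆ = -(a • N.e₂) := by rw [← lie_skew, N.z_e₁]
  have he₂z : ⁅N.e₂, N.z⁆ = a • N.e₁ := by rw [← lie_skew, N.z_e₂, neg_neg]
  have he₂e₁ : ⁅N.e₂, N.e₁⁆ = -(c • N.z + d • N.f) := by rw [← lie_skew, N.e₁_e₂]
  simp only [add_lie, lie_add, smul_lie, lie_smul, lie_self, N.h_f, N.z_h, N.z_f, N.h_e₁, N.h_e₂,
    N.f_e₁, N.f_e₂, N.z_e₁, N.z_e₂, N.e₁_e₂, hzh, hzf, hfh, he₁h, he₂h, he₁f, he₂f, he₁z, he₂z,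
    he₂e₁]
  module

/-- A five-dimensional Lie algebra in normal form is isomorphic to any Lie algebra that has linear
coordinates in which the bracket is given by the structure constants of the normal form. -/
theorem nonempty_equiv (N : NormalForm 𝔤 a k c d) (h5 : Module.finrank ℝ 𝔤 = 5) {L : Type*}
    [LieRing L] [LieAlgebra ℝ L] (κ : L →ₗ[ℝ] Fin 5 → ℝ) (hκ : Function.Bijective κ)
    (h₀ : ∀ x y : L, κ ⁅x, y⁆ 0 = 0)
    (h₁ : ∀ x y : L, κ ⁅x, y⁆ 1 =
      κ x 0 * κ y 1 - κ x 1 * κ y 0 + d * (κ x 3 * κ y 4 - κ x 4 * κ y 3))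
    (h₂ : ∀ x y : L, κ ⁅x, y⁆ 2 = c * (κ x 3 * κ y 4 - κ x 4 * κ y 3))
    (h₃ : ∀ x y : L, κ ⁅x, y⁆ 3 =
      k * (κ x 0 * κ y 3 - κ x 3 * κ y 0) - a * (κ x 2 * κ y 4 - κ x 4 * κ y 2))
    (h₄ : ∀ x y : L, κ ⁅x, y⁆ 4 =
      k * (κ x 0 * κ y 4 - κ x 4 * κ y 0) + a * (κ x 2 * κ y 3 - κ x 3 * κ y 2)) :
    Nonempty (𝔤 ≃ₗ⁅ℝ⁆ L) := by
  have : FiniteDimensional ℝ 𝔤 := Module.finite_of_finrank_pos (by omega)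
  let φ : L →ₗ⁅ℝ⁆ 𝔤 :=
    { toFun := fun x =>
        κ x 0 • N.h + κ x 1 • N.f + κ x 2 • N.z + κ x 3 • N.e₁ + κ x 4 • N.e₂
      map_add' := fun x y => by
        simp only [map_add, Pi.add_apply]
        module
      map_smul' := fun q x => by
        simp only [map_smul, Pi.smul_apply, RingHom.id_apply, smul_eq_mul]
        module
      map_lie' := fun {x y} => by
        rw [N.lie_combination, h₀, h₁, h₂, h₃, h₄] }
  have hφ : ∀ x, φ x = κ x 0 • N.h + κ x 1 • N.f + κ x 2 • N.z + κ x 3 • N.e₁ + κ x 4 • N.e₂ :=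
    fun x => rfl
  refine ⟨(LieEquiv.ofBijective φ ⟨?_, ?_⟩).symm⟩
  · rw [injective_iff_map_eq_zero]
    intro x hx
    obtain ⟨g0, g1, g2, g3, g4⟩ := N.indep ((hφ x).symm.trans hx)
    apply hκ.1
    rw [map_zero]
    funext i
    fin_cases i <;> assumption
  · intro X
    obtain ⟨c₀, c₁, c₂, c₃, c₄, h⟩ := SasakianStructure.span_of_indep h5 N.indep X
    obtain ⟨x, hx⟩ := hκ.2 ![c₀, c₁, c₂, c₃, c₄]
    refine ⟨x, ?_⟩
    rw [hφ, hx, h]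
    rfl

theorem nonempty_equiv_g0 (N : NormalForm 𝔤 a (1 / 2) 0 1) (ha : a ≠ 0)
    (h5 : Module.finrank ℝ 𝔤 = 5) : Nonempty (𝔤 ≃ₗ⁅ℝ⁆ G0) := by
  -- The third basis vector of 𝔤₀ is matched with -f, because its bracket [e₄, e₅] is -e₃; the
  -- second is z / a, which rotates with unit speed.
  let κ : G0 →ₗ[ℝ] Fin 5 → ℝ :=
    { toFun := fun x => ![x 0, -x 2, a⁻¹ * x 1, x 3, x 4]
      map_add' := fun x y => by
        funext i
        fin_cases i <;> simp [G0.add_apply] <;> ring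
      map_smul' := fun q x => by
        funext i
        fin_cases i <;> simp [G0.smul_apply] <;> ring }
  have κ0 : ∀ x, κ x 0 = x 0 := fun x => rfl
  have κ1 : ∀ x, κ x 1 = -x 2 := fun x => rfl
  have κ2 : ∀ x, κ x 2 = a⁻¹ * x 1 := fun x => rfl
  have κ3 : ∀ x, κ x 3 = x 3 := fun x => rfl
  have κ4 : ∀ x, κ x 4 = x 4 := fun x => rfl
  refine N.nonempty_equiv h5 κ ⟨fun x y h => ?_, fun v => ?_⟩ ?_ ?_ ?_ ?_ ?_
  · have h' := congrFun h
    have g0 := h' 0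
    have g1 := h' 1
    have g2 := h' 2
    have g3 := h' 3
    have g4 := h' 4
    rw [κ1, κ1, neg_inj] at g1
    rw [κ2, κ2, mul_right_inj' (inv_ne_zero ha)] at g2
    exact G0.ext g0 g2 g1 g3 g4
  · refine ⟨(![v 0, a * v 2, -v 1, v 3, v 4] : Fin 5 → ℝ), ?_⟩
    funext i
    fin_cases i
    · rfl
    · exact neg_neg (v 1)
    · exact inv_mul_cancel_left₀ ha (v 2)
    · rfl
    · rfl
  all_goals
    refine fun x y => ?_
    simp only [κ0, κ1, κ2, κ3, κ4, G0.lie_zero_coord, G0.lie_one_coord, G0.lie_two_coord,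
      G0.lie_three_coord, G0.lie_four_coord]
    try field_simp
    try ring

end NormalForm

/-! ### Matrix coordinates and the two direct products. -/

theorem SL2Lie.apply_one_one (A : SL2Lie) : A.1 1 1 = -A.1 0 0 := by
  have h : A.1.trace = 0 := A.2
  rw [Matrix.trace_fin_two] at h
  linarith

theorem SL2Lie.lie_apply (A B : SL2Lie) (i j : Fin 2) : ⁅A, B⁆.1 i j =
    A.1 i 0 * B.1 0 j + A.1 i 1 * B.1 1 j - (B.1 i 0 * A.1 0 j + B.1 i 1 * A.1 1 j) := by
  change (A.1 * B.1 - B.1 * A.1) i j = _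
  rw [Matrix.sub_apply, Matrix.mul_apply, Matrix.mul_apply, Fin.sum_univ_two, Fin.sum_univ_two]

theorem SU2Lie.lie_apply (A B : SU2Lie) (i j : Fin 2) : ⁅A, B⁆.1 i j =
    A.1 i 0 * B.1 0 j + A.1 i 1 * B.1 1 j - (B.1 i 0 * A.1 0 j + B.1 i 1 * A.1 1 j) := by
  change (A.1 * B.1 - B.1 * A.1) i j = _
  rw [Matrix.sub_apply, Matrix.mul_apply, Matrix.mul_apply, Fin.sum_univ_two, Fin.sum_univ_two]

theorem SU2Lie.re_zero_zero (A : SU2Lie) : (A.1 0 0).re = 0 := by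
  have h := congrArg Complex.re (congrFun (congrFun A.2.1 0) 0)
  simp only [Matrix.conjTranspose_apply, Matrix.neg_apply, Complex.star_def, Complex.conj_re,
    Complex.neg_re] at h
  linarith

theorem SU2Lie.re_one_zero (A : SU2Lie) : (A.1 1 0).re = -(A.1 0 1).re := by
  have h := congrArg Complex.re (congrFun (congrFun A.2.1 0) 1)
  simp only [Matrix.conjTranspose_apply, Matrix.neg_apply, Complex.star_def, Complex.conj_re,
    Complex.neg_re] at h
  exact h

theorem SU2Lie.im_one_zero (A : SU2Lie) : (A.1 1 0).im = (A.1 0 1).im := by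
  have h := congrArg Complex.im (congrFun (congrFun A.2.1 0) 1)
  simp only [Matrix.conjTranspose_apply, Matrix.neg_apply, Complex.star_def, Complex.conj_im,
    Complex.neg_im] at h
  linarith

theorem SU2Lie.apply_one_one (A : SU2Lie) : A.1 1 1 = -A.1 0 0 := by
  have h : A.1.trace = 0 := A.2.2
  rw [Matrix.trace_fin_two] at h
  linear_combination h

theorem AffLie.lie_apply_zero (A B : AffLie) (j : Fin 2) :
    ⁅A, B⁆.1 0 j = A.1 0 0 * B.1 0 j - B.1 0 0 * A.1 0 j := by
  change (A.1 * B.1 - B.1 * A.1) 0 j = _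
  rw [Matrix.sub_apply, Matrix.mul_apply, Matrix.mul_apply, Fin.sum_univ_two, Fin.sum_univ_two,
    A.2 j, B.2 j]
  ring

theorem AffLie.ext {A B : AffLie} (h0 : A.1 0 0 = B.1 0 0) (h1 : A.1 0 1 = B.1 0 1) : A = B := by
  apply Subtype.ext
  ext i j
  fin_cases i
  · fin_cases j <;> assumption
  · exact (A.2 j).trans (B.2 j).symm

namespace NormalForm

variable {𝔤 : Type*} [LieRing 𝔤] [LieAlgebra ℝ 𝔤] {a : ℝ}

theorem nonempty_equiv_sl2_prod_aff (N : NormalForm 𝔤 a 0 2 0) (ha : a < 0)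
    (h5 : Module.finrank ℝ 𝔤 = 5) : Nonempty (𝔤 ≃ₗ⁅ℝ⁆ (SL2Lie × AffLie)) := by
  obtain ⟨r, hr0, hr⟩ : ∃ r : ℝ, r ≠ 0 ∧ r * r * a = -2 := by
    have h : (0 : ℝ) < -2 / a := div_pos_of_neg_of_neg (by norm_num) ha
    refine ⟨√(-2 / a), (Real.sqrt_pos.mpr h).ne', ?_⟩
    rw [Real.mul_self_sqrt h.le, div_mul_cancel₀ _ ha.ne]
  -- The matrices `!![1, 0; 0, -1]`, `!![0, 1; 1, 0]`, `!![0, 1; -1, 0]` correspond to r e₁, r e₂,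
  -- r² z. The first two bracket to twice the third for any r; the brackets with the third require
  -- r² a = -2, hence a < 0.
  let κ : (SL2Lie × AffLie) →ₗ[ℝ] Fin 5 → ℝ :=
    { toFun := fun x => ![x.2.1 0 0, x.2.1 0 1, r * r * ((x.1.1 0 1 - x.1.1 1 0) / 2),
        r * x.1.1 0 0, r * ((x.1.1 0 1 + x.1.1 1 0) / 2)]
      map_add' := fun x y => by
        funext i
        fin_cases i <;> simp <;> ring
      map_smul' := fun q x => by
        funext i
        fin_cases i <;> simp <;> ring }
  have κ0 : ∀ x, κ x 0 = x.2.1 0 0 := fun x => rfl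
  have κ1 : ∀ x, κ x 1 = x.2.1 0 1 := fun x => rfl
  have κ2 : ∀ x, κ x 2 = r * r * ((x.1.1 0 1 - x.1.1 1 0) / 2) := fun x => rfl
  have κ3 : ∀ x, κ x 3 = r * x.1.1 0 0 := fun x => rfl
  have κ4 : ∀ x, κ x 4 = r * ((x.1.1 0 1 + x.1.1 1 0) / 2) := fun x => rfl
  refine N.nonempty_equiv h5 κ ⟨fun x y h => ?_, fun v => ?_⟩ (fun x y => ?_) (fun x y => ?_)
    (fun x y => ?_) (fun x y => ?_) (fun x y => ?_)
  · have h' := congrFun h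
    have g2 := h' 2
    have g3 := h' 3
    have g4 := h' 4
    rw [κ2, κ2, mul_right_inj' (mul_ne_zero hr0 hr0)] at g2
    rw [κ3, κ3, mul_right_inj' hr0] at g3
    rw [κ4, κ4, mul_right_inj' hr0] at g4
    refine Prod.ext (Subtype.ext ?_) (AffLie.ext (h' 0) (h' 1))
    ext i j
    fin_cases i <;> fin_cases j
    · exact g3
    · change x.1.1 0 1 = y.1.1 0 1
      linarith
    · change x.1.1 1 0 = y.1.1 1 0
      linarith
    · change x.1.1 1 1 = y.1.1 1 1
      rw [SL2Lie.apply_one_one, SL2Lie.apply_one_one, g3]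
  · refine ⟨(⟨!![v 3 / r, v 4 / r + v 2 / (r * r); v 4 / r - v 2 / (r * r), -(v 3 / r)], ?_⟩,
      ⟨!![v 0, v 1; 0, 0], ?_⟩), ?_⟩
    · exact (Matrix.trace_fin_two _).trans (add_neg_cancel (v 3 / r))
    · intro j
      fin_cases j <;> rfl
    · funext i
      fin_cases i
      · rfl
      · rfl
      · change r * r * ((v 4 / r + v 2 / (r * r) - (v 4 / r - v 2 / (r * r))) / 2) = v 2
        field_simp
        ring
      · exact mul_div_cancel₀ (v 3) hr0
      · change r * ((v 4 / r + v 2 / (r * r) + (v 4 / r - v 2 / (r * r))) / 2) = v 4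
        field_simp
        ring
  · simp only [κ0, LieAlgebra.Prod.bracket_apply, AffLie.lie_apply_zero]
    ring
  · simp only [κ0, κ1, LieAlgebra.Prod.bracket_apply, AffLie.lie_apply_zero]
    ring
  · simp only [κ2, κ3, κ4, LieAlgebra.Prod.bracket_apply, SL2Lie.lie_apply, SL2Lie.apply_one_one]
    ring
  · simp only [κ0, κ2, κ3, κ4, LieAlgebra.Prod.bracket_apply, SL2Lie.lie_apply]
    linear_combination r * (x.1.1 0 1 * y.1.1 1 0 - x.1.1 1 0 * y.1.1 0 1) / 2 * hr
  · simp only [κ0, κ2, κ3, κ4, LieAlgebra.Prod.bracket_apply, SL2Lie.lie_apply,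
      SL2Lie.apply_one_one]
    linear_combination r * (x.1.1 0 0 * y.1.1 0 1 - x.1.1 0 1 * y.1.1 0 0 +
      x.1.1 1 0 * y.1.1 0 0 - x.1.1 0 0 * y.1.1 1 0) / 2 * hr

theorem nonempty_equiv_su2_prod_aff (N : NormalForm 𝔤 a 0 2 0) (ha : 0 < a)
    (h5 : Module.finrank ℝ 𝔤 = 5) : Nonempty (𝔤 ≃ₗ⁅ℝ⁆ (SU2Lie × AffLie)) := by
  obtain ⟨r, hr0, hr⟩ : ∃ r : ℝ, r ≠ 0 ∧ r * r * a = 2 := by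
    have h : (0 : ℝ) < 2 / a := div_pos (by norm_num) ha
    refine ⟨√(2 / a), (Real.sqrt_pos.mpr h).ne', ?_⟩
    rw [Real.mul_self_sqrt h.le, div_mul_cancel₀ _ ha.ne']
  -- Here diag(i, -i) corresponds to r² z, and the off-diagonal matrices with upper right entry 1
  -- and i to r e₁ and r e₂; rotation by diag(i, -i) has speed 2, hence r² a = 2.
  let κ : (SU2Lie × AffLie) →ₗ[ℝ] Fin 5 → ℝ :=
    { toFun := fun x => ![x.2.1 0 0, x.2.1 0 1, r * r * (x.1.1 0 0).im,
        r * (x.1.1 0 1).re, r * (x.1.1 0 1).im]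
      map_add' := fun x y => by
        funext i
        fin_cases i <;> simp <;> ring
      map_smul' := fun q x => by
        funext i
        fin_cases i <;> simp <;> ring }
  have κ0 : ∀ x, κ x 0 = x.2.1 0 0 := fun x => rfl
  have κ1 : ∀ x, κ x 1 = x.2.1 0 1 := fun x => rfl
  have κ2 : ∀ x, κ x 2 = r * r * (x.1.1 0 0).im := fun x => rfl
  have κ3 : ∀ x, κ x 3 = r * (x.1.1 0 1).re := fun x => rfl
  have κ4 : ∀ x, κ x 4 = r * (x.1.1 0 1).im := fun x => rfl
  refine N.nonempty_equiv h5 κ ⟨fun x y h => ?_, fun v => ?_⟩ (fun x y => ?_) (fun x y => ?_)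
    (fun x y => ?_) (fun x y => ?_) (fun x y => ?_)
  · have h' := congrFun h
    have g2 := h' 2
    have g3 := h' 3
    have g4 := h' 4
    rw [κ2, κ2, mul_right_inj' (mul_ne_zero hr0 hr0)] at g2
    rw [κ3, κ3, mul_right_inj' hr0] at g3
    rw [κ4, κ4, mul_right_inj' hr0] at g4
    have g00 : x.1.1 0 0 = y.1.1 0 0 :=
      Complex.ext (by rw [SU2Lie.re_zero_zero, SU2Lie.re_zero_zero]) g2
    refine Prod.ext (Subtype.ext ?_) (AffLie.ext (h' 0) (h' 1))
    funext i j
    fin_cases i <;> fin_cases j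
    · exact g00
    · exact Complex.ext g3 g4
    · change x.1.1 1 0 = y.1.1 1 0
      apply Complex.ext
      · rw [SU2Lie.re_one_zero, SU2Lie.re_one_zero, g3]
      · rw [SU2Lie.im_one_zero, SU2Lie.im_one_zero, g4]
    · change x.1.1 1 1 = y.1.1 1 1
      rw [SU2Lie.apply_one_one, SU2Lie.apply_one_one, g00]
  · refine ⟨(⟨!![⟨0, v 2 / (r * r)⟩, ⟨v 3 / r, v 4 / r⟩; ⟨-(v 3 / r), v 4 / r⟩,
      ⟨0, -(v 2 / (r * r))⟩], ?_, ?_⟩, ⟨!![v 0, v 1; 0, 0], ?_⟩), ?_⟩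
    · funext i j
      fin_cases i <;> fin_cases j <;> simp [Complex.ext_iff]
    · rw [Matrix.trace_fin_two]
      simp [Complex.ext_iff]
    · intro j
      fin_cases j <;> rfl
    · funext i
      fin_cases i
      · rfl
      · rfl
      · exact mul_div_cancel₀ (v 2) (mul_ne_zero hr0 hr0)
      · exact mul_div_cancel₀ (v 3) hr0
      · exact mul_div_cancel₀ (v 4) hr0
  · simp only [κ0, LieAlgebra.Prod.bracket_apply, AffLie.lie_apply_zero]
    ring
  · simp only [κ0, κ1, LieAlgebra.Prod.bracket_apply, AffLie.lie_apply_zero]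
    ring
  · simp only [κ2, κ3, κ4, LieAlgebra.Prod.bracket_apply, SU2Lie.lie_apply, Complex.sub_im,
      Complex.add_im, Complex.mul_im, SU2Lie.re_one_zero, SU2Lie.im_one_zero,
      SU2Lie.re_zero_zero]
    ring
  · simp only [κ0, κ2, κ3, κ4, LieAlgebra.Prod.bracket_apply, SU2Lie.lie_apply, Complex.sub_re,
      Complex.add_re, Complex.mul_re, SU2Lie.re_zero_zero, SU2Lie.apply_one_one, Complex.neg_re,
      Complex.neg_im]
    linear_combination r * ((x.1.1 0 0).im * (y.1.1 0 1).im -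
      (x.1.1 0 1).im * (y.1.1 0 0).im) * hr
  · simp only [κ0, κ2, κ3, κ4, LieAlgebra.Prod.bracket_apply, SU2Lie.lie_apply, Complex.sub_im,
      Complex.add_im, Complex.mul_im, SU2Lie.re_zero_zero, SU2Lie.apply_one_one, Complex.neg_re,
      Complex.neg_im]
    linear_combination -r * ((x.1.1 0 0).im * (y.1.1 0 1).re -
      (x.1.1 0 1).re * (y.1.1 0 0).im) * hr

end NormalForm

/-! ### Properties of 𝔤₀. -/

/-- The map ad e₁ is diagonal with entries 0, 0, 1, 1/2, 1/2, so its trace is 2. -/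
theorem G0.not_isUnimodularLie : ¬ IsUnimodularLie G0 := by
  intro h
  have h0 := h (G0.e 0)
  let b : Module.Basis (Fin 5) ℝ G0 := Pi.basisFun ℝ (Fin 5)
  have hb : ∀ i, b i = G0.e i := fun i => by
    funext j
    have hj := congrFun (Pi.basisFun_apply ℝ (Fin 5) i) j
    rw [Pi.single_apply] at hj
    exact hj
  have hr : ∀ (x : G0) i, b.repr x i = x i := fun x i => rfl
  rw [LinearMap.trace_eq_matrix_trace ℝ b, Matrix.trace, Fin.sum_univ_five] at h0
  simp only [Matrix.diag_apply, LinearMap.toMatrix_apply, LieAlgebra.ad_apply, hb, hr,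
    G0.lie_zero_coord, G0.lie_one_coord, G0.lie_two_coord, G0.lie_three_coord, G0.lie_four_coord,
    G0.e_apply] at h0
  norm_num +decide at h0

/-- The derived series descends through I = span(e₃, e₄, e₅), a Heisenberg ideal, and its center J =
span(e₃). -/
theorem G0.isSolvable : LieAlgebra.IsSolvable G0 := by
  let I : LieIdeal ℝ G0 :=
    { carrier := {x | x 0 = 0 ∧ x 1 = 0}
      add_mem' := by
        rintro x y ⟨hx, hx'⟩ ⟨hy, hy'⟩
        simp [G0.add_apply, hx, hx', hy, hy']
      zero_mem' := ⟨rfl, rfl⟩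
      smul_mem' := by
        rintro c x ⟨hx, hx'⟩
        simp [G0.smul_apply, hx, hx']
      lie_mem := fun _ => ⟨rfl, rfl⟩ }
  let J : LieIdeal ℝ G0 :=
    { carrier := {x | x 0 = 0 ∧ x 1 = 0 ∧ x 3 = 0 ∧ x 4 = 0}
      add_mem' := by
        rintro x y ⟨hx0, hx1, hx3, hx4⟩ ⟨hy0, hy1, hy3, hy4⟩
        simp [G0.add_apply, hx0, hx1, hx3, hx4, hy0, hy1, hy3, hy4]
      zero_mem' := ⟨rfl, rfl, rfl, rfl⟩
      smul_mem' := by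
        rintro c x ⟨hx0, hx1, hx3, hx4⟩
        simp [G0.smul_apply, hx0, hx1, hx3, hx4]
      lie_mem := by
        rintro x y ⟨hy0, hy1, hy3, hy4⟩
        refine ⟨rfl, rfl, ?_, ?_⟩
        · simp [G0.lie_three_coord, hy0, hy1, hy3, hy4]
        · simp [G0.lie_four_coord, hy0, hy1, hy3, hy4] }
  have h1 : ⁅(⊤ : LieIdeal ℝ G0), (⊤ : LieIdeal ℝ G0)⁆ ≤ I := by
    rw [LieSubmodule.lieIdeal_oper_eq_span, LieSubmodule.lieSpan_le]
    rintro _ ⟨x, y, rfl⟩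
    exact ⟨rfl, rfl⟩
  have h2 : ⁅I, I⁆ ≤ J := by
    rw [LieSubmodule.lieIdeal_oper_eq_span, LieSubmodule.lieSpan_le]
    rintro _ ⟨⟨x, hx0, hx1⟩, ⟨y, hy0, hy1⟩, rfl⟩
    refine ⟨rfl, rfl, ?_, ?_⟩
    · simp [G0.lie_three_coord, hx0, hx1, hy0, hy1]
    · simp [G0.lie_four_coord, hx0, hx1, hy0, hy1]
  have h3 : ⁅J, J⁆ = ⊥ := by
    rw [← le_bot_iff, LieSubmodule.lieIdeal_oper_eq_span, LieSubmodule.lieSpan_le]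
    rintro _ ⟨⟨x, hx0, hx1, hx3, hx4⟩, ⟨y, hy0, hy1, hy3, hy4⟩, rfl⟩
    apply G0.ext <;>
      simp [G0.lie_zero_coord, G0.lie_one_coord, G0.lie_two_coord, G0.lie_three_coord,
        G0.lie_four_coord, G0.zero_apply, hx0, hx1, hx3, hx4, hy0, hy1, hy3, hy4]
  apply LieAlgebra.IsSolvable.mk (R := ℝ) (k := 3)
  rw [LieAlgebra.derivedSeries_def, LieAlgebra.derivedSeriesOfIdeal_succ,
    LieAlgebra.derivedSeriesOfIdeal_succ, LieAlgebra.derivedSeriesOfIdeal_succ,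
    LieAlgebra.derivedSeriesOfIdeal_zero, ← le_bot_iff, ← h3]
  have h21 := (LieSubmodule.mono_lie h1 h1).trans h2
  exact LieSubmodule.mono_lie h21 h21

theorem Heis3.sub_apply (x y : Heis3) (i : Fin 3) : (x - y) i = x i - y i := rfl

noncomputable section

/-- The linear endomorphism of `𝔥₃` scaling `X, Y` by `v.1 / 2` and `Z` by `v.1`, and rotating the
plane of `X, Y` with speed `v.2`. -/
def Heis3.scaleRotateFun (v : ℝ × ℝ) (x : Heis3) : Heis3 :=
  ![v.1 / 2 * x 0 - v.2 * x 1, v.1 / 2 * x 1 + v.2 * x 0, v.1 * x 2]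

theorem Heis3.scaleRotateFun_zero_coord (v : ℝ × ℝ) (x : Heis3) :
    Heis3.scaleRotateFun v x 0 = v.1 / 2 * x 0 - v.2 * x 1 := rfl

theorem Heis3.scaleRotateFun_one_coord (v : ℝ × ℝ) (x : Heis3) :
    Heis3.scaleRotateFun v x 1 = v.1 / 2 * x 1 + v.2 * x 0 := rfl

theorem Heis3.scaleRotateFun_two_coord (v : ℝ × ℝ) (x : Heis3) :
    Heis3.scaleRotateFun v x 2 = v.1 * x 2 := rfl

/-- `Heis3.scaleRotateFun` as a derivation. -/
def Heis3.scaleRotate (v : ℝ × ℝ) : LieDerivation ℝ Heis3 Heis3 where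
  toFun := Heis3.scaleRotateFun v
  map_add' x y := by
    apply Heis3.ext <;>
      simp only [Heis3.add_apply, Heis3.scaleRotateFun_zero_coord, Heis3.scaleRotateFun_one_coord,
        Heis3.scaleRotateFun_two_coord] <;> ring
  map_smul' c x := by
    apply Heis3.ext <;>
      simp only [Heis3.smul_apply, Heis3.scaleRotateFun_zero_coord, RingHom.id_apply,
        Heis3.scaleRotateFun_one_coord, Heis3.scaleRotateFun_two_coord] <;> ring
  leibniz' x y := by
    apply Heis3.ext <;>
      simp only [LinearMap.coe_mk, AddHom.coe_mk, Heis3.sub_apply, Heis3.lie_zero_coord,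
        Heis3.lie_one_coord, Heis3.lie_two_coord, Heis3.scaleRotateFun_zero_coord,
        Heis3.scaleRotateFun_one_coord, Heis3.scaleRotateFun_two_coord] <;> ring

theorem Heis3.scaleRotate_apply (v : ℝ × ℝ) (x : Heis3) :
    Heis3.scaleRotate v x = Heis3.scaleRotateFun v x := rfl

/-- The action of the abelian Lie algebra `ℝ²` on `𝔥₃` by the derivations `Heis3.scaleRotate`. -/
def Heis3.scaleRotateHom : (ℝ × ℝ) →ₗ⁅ℝ⁆ LieDerivation ℝ Heis3 Heis3 where
  toFun := Heis3.scaleRotate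
  map_add' v w := by
    ext x
    rw [LieDerivation.add_apply]
    simp only [Heis3.scaleRotate_apply]
    apply Heis3.ext <;>
      simp only [Heis3.add_apply, Heis3.scaleRotateFun_zero_coord, Heis3.scaleRotateFun_one_coord,
        Heis3.scaleRotateFun_two_coord, Prod.fst_add, Prod.snd_add] <;> ring
  map_smul' c v := by
    ext x
    rw [LieDerivation.smul_apply]
    simp only [Heis3.scaleRotate_apply]
    apply Heis3.ext <;>
      simp only [Heis3.smul_apply, Heis3.scaleRotateFun_zero_coord, Heis3.scaleRotateFun_one_coord,
        Heis3.scaleRotateFun_two_coord, Prod.smul_fst, Prod.smul_snd, RingHom.id_apply,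
        smul_eq_mul] <;> ring
  map_lie' := by
    intro v w
    -- The bracket of ℝ × ℝ is the componentwise commutator, hence zero; it remains to see that the
    -- derivations commute.
    have h : ⁅v, w⁆ = 0 := by
      refine Prod.ext ?_ ?_
      · change v.1 * w.1 - w.1 * v.1 = 0
        ring
      · change v.2 * w.2 - w.2 * v.2 = 0
        ring
    ext x
    rw [LieDerivation.lie_apply, h]
    simp only [Heis3.scaleRotate_apply]
    apply Heis3.ext <;>
      simp only [Heis3.sub_apply, Heis3.scaleRotateFun_zero_coord, Heis3.scaleRotateFun_one_coord,
        Heis3.scaleRotateFun_two_coord, Prod.fst_zero, Prod.snd_zero] <;> ring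

/-- `𝔤₀` as a semidirect product of `𝔥₃` by `ℝ²`. -/
def G0.equivSemiDirectSum :
    G0 ≃ₗ⁅ℝ⁆ LieAlgebra.SemiDirectSum Heis3 (ℝ × ℝ) Heis3.scaleRotateHom where
  -- The sign appears because [X, Y] = Z while [e₄, e₅] = -e₃.
  toFun x := ⟨(![x 3, x 4, -x 2] : Fin 3 → ℝ), (x 0, x 1)⟩
  invFun y := (![y.right.1, y.right.2, -y.left 2, y.left 0, y.left 1] : Fin 5 → ℝ)
  map_add' x y := by
    refine LieAlgebra.SemiDirectSum.ext (Heis3.ext rfl rfl ?_) rfl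
    exact neg_add (x 2) (y 2)
  map_smul' c x := by
    refine LieAlgebra.SemiDirectSum.ext (Heis3.ext rfl rfl ?_) rfl
    exact (mul_neg c (x 2)).symm
  map_lie' := by
    intro x y
    refine LieAlgebra.SemiDirectSum.ext (Heis3.ext ?_ ?_ ?_) (Prod.ext ?_ ?_)
    · change ⁅x, y⁆ 3 = 0 + (x 0 / 2 * y 3 - x 1 * y 4) - (y 0 / 2 * x 3 - y 1 * x 4)
      rw [G0.lie_three_coord]
      ring
    · change ⁅x, y⁆ 4 = 0 + (x 0 / 2 * y 4 + x 1 * y 3) - (y 0 / 2 * x 4 + y 1 * x 3)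
      rw [G0.lie_four_coord]
      ring
    · change -⁅x, y⁆ 2 = (x 3 * y 4 - x 4 * y 3) + (x 0 * -y 2) - (y 0 * -x 2)
      rw [G0.lie_two_coord]
      ring
    · change 0 = x 0 * y 0 - y 0 * x 0
      ring
    · change 0 = x 1 * y 1 - y 1 * x 1
      ring
  left_inv x := G0.ext rfl rfl (neg_neg (x 2)) rfl rfl
  right_inv y := LieAlgebra.SemiDirectSum.ext (Heis3.ext rfl rfl (neg_neg (y.left 2))) rfl

end

theorem mainTheorem2 :
    (∀ (𝔤 : Type*) [LieRing 𝔤] [LieAlgebra ℝ 𝔤],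
      Module.finrank ℝ 𝔤 = 5 →
      Nonempty (SasakianStructure 𝔤) →
      LieAlgebra.center ℝ 𝔤 = ⊥ →
        Nonempty (𝔤 ≃ₗ⁅ℝ⁆ (SL2Lie × AffLie)) ∨
        Nonempty (𝔤 ≃ₗ⁅ℝ⁆ (SU2Lie × AffLie)) ∨
        Nonempty (𝔤 ≃ₗ⁅ℝ⁆ G0)) ∧
    LieAlgebra.IsSolvable G0 ∧
    ¬ IsUnimodularLie G0 ∧
    ∃ ψ : (ℝ × ℝ) →ₗ⁅ℝ⁆ LieDerivation ℝ Heis3 Heis3,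
      Nonempty (G0 ≃ₗ⁅ℝ⁆ LieAlgebra.SemiDirectSum Heis3 (ℝ × ℝ) ψ) := by
  refine ⟨?_, G0.isSolvable, G0.not_isUnimodularLie, Heis3.scaleRotateHom,
    ⟨G0.equivSemiDirectSum⟩⟩
  rintro 𝔤 _ _ h5 ⟨S⟩ hc
  obtain ⟨a, b, ha, ⟨F⟩⟩ := S.exists_frame h5 hc
  obtain rfl := F.b_eq_zero ha
  obtain ⟨k, d, ⟨N⟩⟩ := F.exists_normalForm ha
  obtain ⟨rfl, rfl⟩ | ⟨rfl, rfl⟩ := N.dichotomy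
  · rw [mul_zero, sub_zero] at N
    rcases ha.lt_or_gt with ha | ha
    · exact Or.inl (N.nonempty_equiv_sl2_prod_aff ha h5)
    · exact Or.inr (Or.inl (N.nonempty_equiv_su2_prod_aff ha h5))
  · rw [mul_one, sub_self] at N
    exact Or.inr (Or.inr (N.nonempty_equiv_g0 ha h5))
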